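/- Let $\mathbb S^3=\{x\in\mathbb R^4:|x|=1\}$ carry the round metric and let $\Delta_{\mathbb S^3}$ be its Laplace–Beltrami operator (with the sign convention $\Delta=\operatorname{div}\nabla$). Let $\mathbb T^2=\mathbb S^1\times\mathbb S^1$ act on $\mathbb S^3$ by $(\alpha,\beta)(x,y,z,w)=(\alpha\cdot(x,y),\beta\cdot(z,w))$, where $\cdot$ is complex multiplication. Every point of $\mathbb S^3$ can be written as $$x(\theta,\eta_1,\eta_2)=(\cos\theta\cos\eta_1,\ \cos\theta\sin\eta_1,\ \sin\theta\cos\eta_2,\ \sin\theta\sin\eta_2),\qquad \theta\in[0,\pi/2],\ \eta_1,\eta_2\in\mathbb R .$$ **Theorem.** Let $n\ge 1$ be an integer and let $\lambda\in[-(2n+2)(2n+3),\,-2n(2n+1))$ be real. Then for every $k\in\{1,2,\dots,n\}$ there is a $\mathbb T^2$-invariant function $U_k\in C^2(\mathbb S^3)$ such that $$\Delta_{\mathbb S^3}U_k=\lambda\,(U_k^5-U_k),\qquad U_k>0\qquad\text{on all of }\mathbb S^3,$$ and such that the function $u_k$ on $[0,\pi/2]$ defined by $U_k(x(\theta,\eta_1,\eta_2))=u_k(\theta)$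 has the following properties: * $u_k$ has exactly $k$ local maxima on the open interval $(0,\pi/2)$; * $u_k(\pi/2-\theta)=u_k(\theta)$ for all $\theta\in[0,\pi/2]$; * $u_k(0)<1$. -/

import Mathlib

open Real Set
open scoped Manifold

/-- The Euclidean space `ℝ⁴`. -/
abbrev R4 : Type := EuclideanSpace ℝ (Fin 4)

/-- The unit sphere `𝕊³ ⊂ ℝ⁴`, with Mathlib's smooth structure (stereographic charts). -/
abbrev S3 : Type := Metric.sphere (0 : R4) 1

theorem mem_S3_iff (a b c d : ℝ) :
    !₂[a, b, c, d] ∈ Metric.sphere (0 : R4) 1 ↔ a ^ 2 + b ^ 2 + c ^ 2 + d ^ 2 = 1 := by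
  rw [mem_sphere_zero_iff_norm, EuclideanSpace.norm_eq, Real.sqrt_eq_one]
  simp [Fin.sum_univ_four]

noncomputable section

/-- The inverse of the chart of `𝕊³` at `p`, as a map into the ambient space `ℝ⁴`. -/
def chartInv (p : S3) (y : EuclideanSpace ℝ (Fin 3)) : R4 :=
  (((extChartAt (𝓡 3) p).symm y : S3) : R4)

/-- The partial derivative `∂f/∂yᵢ` in a coordinate space `ℝ³`. -/
def partialDeriv {F : Type*} [NormedAddCommGroup F] [NormedSpace ℝ F] (i : Fin 3)
    (f : EuclideanSpace ℝ (Fin 3) → F) (y : EuclideanSpace ℝ (Fin 3)) : F :=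
  fderiv ℝ f y (EuclideanSpace.single i 1)

/-- The matrix `(gᵢⱼ)` of the round metric (induced from `ℝ⁴`) in the coordinates of the chart
at `p`. -/
def roundMetric (p : S3) (y : EuclideanSpace ℝ (Fin 3)) : Matrix (Fin 3) (Fin 3) ℝ :=
  Matrix.of fun i j =>
    inner ℝ (partialDeriv i (chartInv p) y) (partialDeriv j (chartInv p) y)

/-- The Laplace–Beltrami operator of the round sphere `𝕊³`:
`Δ U = |g|^(-1/2) ∑ᵢⱼ ∂ᵢ (|g|^(1/2) gⁱʲ ∂ⱼ U)`,
evaluated at `p` in the coordinates of the chart at `p`. -/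
def laplaceBeltrami (U : S3 → ℝ) (p : S3) : ℝ :=
  (√(roundMetric p (extChartAt (𝓡 3) p p)).det)⁻¹ *
    ∑ i, partialDeriv i
      (fun y => √(roundMetric p y).det *
        ∑ j, (roundMetric p y)⁻¹ i j *
          partialDeriv j (fun z => U ((extChartAt (𝓡 3) p).symm z)) y)
      (extChartAt (𝓡 3) p p)

/-- The action of `𝕋² = 𝕊¹ × 𝕊¹` on `𝕊³`:
`(α, β) (x, y, z, w) = (α · (x, y), β · (z, w))`, where `·` is complex multiplication. -/
def torusAct (α β : Circle) (x : S3) : S3 :=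
  ⟨!₂[((α : ℂ) * ⟨x.1 0, x.1 1⟩).re, ((α : ℂ) * ⟨x.1 0, x.1 1⟩).im,
      ((β : ℂ) * ⟨x.1 2, x.1 3⟩).re, ((β : ℂ) * ⟨x.1 2, x.1 3⟩).im], by
    have hx : (x.1 0) ^ 2 + (x.1 1) ^ 2 + (x.1 2) ^ 2 + (x.1 3) ^ 2 = 1 := by
      have h := x.2
      rw [mem_sphere_zero_iff_norm, EuclideanSpace.norm_eq, Real.sqrt_eq_one] at h
      simpa [Fin.sum_univ_four] using h
    have h1 := Circle.normSq_coe α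
    have h2 := Circle.normSq_coe β
    rw [Complex.normSq_apply] at h1 h2
    rw [mem_S3_iff]
    simp only [Complex.mul_re, Complex.mul_im]
    linear_combination ((x.1 0) ^ 2 + (x.1 1) ^ 2) * h1 + ((x.1 2) ^ 2 + (x.1 3) ^ 2) * h2 + hx⟩

/-- A function on `𝕊³` is `𝕋²`-invariant. -/
def TorusInvariant (U : S3 → ℝ) : Prop :=
  ∀ (α β : Circle) (x : S3), U (torusAct α β x) = U x

/-- The point of `𝕊³` with coordinates `(θ, η₁, η₂)`. For `0 ≤ θ ≤ π / 2` the number `θ` is the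
geodesic distance to the singular orbit `𝕊¹ × {0}`. -/
def torusPoint (θ η₁ η₂ : ℝ) : S3 :=
  ⟨!₂[cos θ * cos η₁, cos θ * sin η₁, sin θ * cos η₂, sin θ * sin η₂], by
    rw [mem_S3_iff]
    linear_combination (cos θ) ^ 2 * sin_sq_add_cos_sq η₁ +
      (sin θ) ^ 2 * sin_sq_add_cos_sq η₂ + sin_sq_add_cos_sq θ⟩

/-- `U` is a (classical) solution of `Δ U = lam (U⁵ - U)`, `U > 0`, on `𝕊³`. -/
structure IsGroundState (lam : ℝ) (U : S3 → ℝ) : Prop where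
  contMDiff : ContMDiff (𝓡 3) 𝓘(ℝ, ℝ) 2 U
  eqn : ∀ x, laplaceBeltrami U x = lam * (U x ^ 5 - U x)
  pos : ∀ x, 0 < U x

end

/-!
The solutions are sought as `U(x) = f(s)` with the latitude `s = x² + y² - z² - w²`, which equals
`cos 2θ`. For such functions the Laplacian is `4 ((1 - s²) f'' - 2 s f')`
(`laplaceBeltrami_comp_latitude`): the charts of `𝕊³` are stereographic, hence conformal, and their
conformal factor is critical at the centre. With `r = 1 - s` and `c = -lam / 4` the equation
becomes `(r (2 - r) g')' = -c (g⁵ - g)` on `[0, 1]`, and an even `f` is obtained from a solution with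
`g'(1) = 0` by reflection, `f(s) = g(1 - |s|)`.

The equation has a solution regular at the singular point `r = 0` for each value `d = g(0)`; it
comes from Banach's fixed point theorem and depends continuously on `d` (`exists_regular_flow`). For
`d ∈ (0, 1)` a decreasing energy keeps `g` positive and bounded (`IsProfile.mem_Ioo`).
The difference `g - 1` solves a linear Sturm–Liouville equation with positive coefficient, so the
curve `(g - 1, r (2 - r) g')` turns monotonically about the origin; its angle is `phase`, and
critical points of `g` in `(0, 1]` correspond to the angles `π, 2π, …`. The angle at `r = 1` is less
than `π` for `d` near `0`. For `d` near `1` the coefficient `c (g⁵ - g) / (g - 1)` is close to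
`4 c = -lam > 2n (2n + 1)`, so Sturm comparison (`RegularSolution.phase_lt_phase`) with the Legendre
polynomial of degree `2n`, whose angle is at least `n π` (`mul_pi_le_legendrePhase`), shows
that the angle is at least `n π`. By the intermediate value theorem some `d` has angle exactly `k π`
at `r = 1` (`exists_profile_phase_eq`). Then `g'(1) = 0`, and after reflection the angle runs through
`[0, 2 k π]`; the local maxima are the points where it is an odd multiple of `π`, and there
are `k` of these (`encard_isLocalMax_eq`).
-/

/-! ### Phase angles of singular Sturm–Liouville solutions -/

/-- A solution, regular at the singular point `r = 0`, of `(r (2 - r) z')' = -Q z` on `[0, 1]`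
with `Q > 0` and `z(0) < 0`. Here `y` is the derivative of `z` and `P` is the flux `r (2 - r) z'`.
The derivatives are required on the whole line, so that no one-sided derivatives occur; only
the interval `[0, 1]` carries the equation. -/
structure RegularSolution (Q z y P : ℝ → ℝ) : Prop where
  hasDerivAt_z : ∀ r, HasDerivAt z (y r) r
  hasDerivAt_P : ∀ r, HasDerivAt P (-(Q r * z r)) r
  flux_eq : ∀ r ∈ Icc (0 : ℝ) 1, P r = r * (2 - r) * y r
  continuous_y : Continuous y
  continuous_Q : Continuous Q
  Q_pos : ∀ r ∈ Icc (0 : ℝ) 1, 0 < Q r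
  z_zero_neg : z 0 < 0

/-- Truncation of a real number to `[0, 1]`. -/
def clampUnit (r : ℝ) : ℝ := max 0 (min 1 r)

theorem clampUnit_mem (r : ℝ) : clampUnit r ∈ Icc (0 : ℝ) 1 :=
  ⟨le_max_left _ _, max_le zero_le_one (min_le_left _ _)⟩

theorem clampUnit_of_mem {r : ℝ} (hr : r ∈ Icc (0 : ℝ) 1) : clampUnit r = r := by
  rw [clampUnit, min_eq_right hr.2, max_eq_right hr.1]

theorem continuous_clampUnit : Continuous clampUnit := by
  unfold clampUnit; fun_prop

/-- The angular speed of the curve `(z, P)` in the phase plane. -/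
noncomputable def phaseSpeed (Q z y P : ℝ → ℝ) (r : ℝ) : ℝ :=
  (Q r * z r ^ 2 + y r * P r) / (z r ^ 2 + P r ^ 2)

/-- The angle swept out by `(z, P)` in the phase plane up to `r`, measured from the negative
`z`-axis. The integrand is truncated to `[0, 1]`, where the curve is known to avoid the origin. -/
noncomputable def phase (Q z y P : ℝ → ℝ) (r : ℝ) : ℝ :=
  ∫ ρ in (0 : ℝ)..r, phaseSpeed Q z y P (clampUnit ρ)

@[simp] theorem phase_zero (Q z y P : ℝ → ℝ) : phase Q z y P 0 = 0 := by simp [phase]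

namespace RegularSolution

variable {Q z y P : ℝ → ℝ} (h : RegularSolution Q z y P)
include h

theorem continuous_z : Continuous z :=
  continuous_iff_continuousAt.2 fun r => (h.hasDerivAt_z r).continuousAt

theorem continuous_P : Continuous P :=
  continuous_iff_continuousAt.2 fun r => (h.hasDerivAt_P r).continuousAt

theorem P_zero : P 0 = 0 := by rw [h.flux_eq 0 (by simp)]; ring

/-- The phase curve avoids the origin: Gronwall's inequality on `[ε, r]` would propagate a zero
of `z ^ 2 + P ^ 2` down to `ε`, for every `ε > 0`, against `z(0) ≠ 0`. -/
theorem normSq_pos {r : ℝ} (hr : r ∈ Icc (0 : ℝ) 1) : 0 < z r ^ 2 + P r ^ 2 := by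
  by_contra hcon
  have hR : z r ^ 2 + P r ^ 2 = 0 := le_antisymm (not_lt.1 hcon) (by positivity)
  have hzr : z r = 0 := by nlinarith [sq_nonneg (z r), sq_nonneg (P r)]
  have hr0 : 0 < r := by
    rcases hr.1.eq_or_lt with h0 | h0
    · rw [← h0] at hzr; exact absurd hzr h.z_zero_neg.ne
    · exact h0
  obtain ⟨K, hK⟩ : ∃ K, ∀ ρ ∈ Icc (0 : ℝ) 1, |Q ρ| ≤ K := by
    obtain ⟨K, hK⟩ := isCompact_Icc.exists_bound_of_continuousOn
      (h.continuous_Q.continuousOn (s := Icc (0 : ℝ) 1))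
    exact ⟨K, fun ρ hρ => by simpa using hK ρ hρ⟩
  have hvanish : ∀ ε ∈ Ioc (0 : ℝ) r, z ε = 0 := by
    intro ε hε
    set L := ε⁻¹ + K with hL
    have hmono : MonotoneOn (fun ρ => (z ρ ^ 2 + P ρ ^ 2) * exp (L * ρ)) (Icc ε r) := by
      have hd : ∀ ρ, HasDerivAt (fun ρ => (z ρ ^ 2 + P ρ ^ 2) * exp (L * ρ))
          ((2 * z ρ * y ρ + 2 * P ρ * -(Q ρ * z ρ)) * exp (L * ρ) +
            (z ρ ^ 2 + P ρ ^ 2) * (exp (L * ρ) * L)) ρ := by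
        intro ρ
        have h1 := ((h.hasDerivAt_z ρ).pow 2).add ((h.hasDerivAt_P ρ).pow 2)
        have h2 : HasDerivAt (fun ρ : ℝ => exp (L * ρ)) (exp (L * ρ) * L) ρ := by
          simpa using ((hasDerivAt_id ρ).const_mul L).exp
        exact (h1.mul h2).congr_deriv (by simp)
      refine monotoneOn_of_deriv_nonneg (convex_Icc _ _)
        (fun ρ _ => (hd ρ).continuousAt.continuousWithinAt)
        (fun ρ _ => (hd ρ).differentiableAt.differentiableWithinAt) ?_
      intro ρ hρ
      rw [interior_Icc] at hρ
      rw [(hd ρ).deriv]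
      have hρ' : ρ ∈ Icc (0 : ℝ) 1 := ⟨(hε.1.trans hρ.1).le, hρ.2.le.trans hr.2⟩
      have hρ0 : 0 < ρ := hε.1.trans hρ.1
      have hp : 0 < ρ * (2 - ρ) := mul_pos hρ0 (by linarith [hρ'.2])
      have hy : y ρ = P ρ / (ρ * (2 - ρ)) := by
        rw [h.flux_eq ρ hρ', mul_div_cancel_left₀ _ hp.ne']
      have hcoef : |1 / (ρ * (2 - ρ)) - Q ρ| ≤ L := by
        have h1 : 1 / (ρ * (2 - ρ)) ≤ ε⁻¹ := by
          rw [one_div]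
          apply inv_anti₀ hε.1
          nlinarith [hρ.1, hρ'.2]
        have h2 := abs_le.1 (hK ρ hρ')
        have h3 : 0 < 1 / (ρ * (2 - ρ)) := by positivity
        rw [abs_le]
        constructor <;> linarith [inv_pos.2 hε.1]
      have key : 0 ≤ 2 * z ρ * y ρ + 2 * P ρ * -(Q ρ * z ρ) + (z ρ ^ 2 + P ρ ^ 2) * L := by
        have e : 2 * z ρ * y ρ + 2 * P ρ * -(Q ρ * z ρ) =
            2 * (z ρ * P ρ) * (1 / (ρ * (2 - ρ)) - Q ρ) := by rw [hy]; ring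
        rw [e]
        have h4 := abs_le.1 hcoef
        nlinarith [mul_nonneg (sq_nonneg (z ρ + P ρ)) (by linarith : 0 ≤ L + (1 / (ρ * (2 - ρ)) - Q ρ)),
          mul_nonneg (sq_nonneg (z ρ - P ρ)) (by linarith : 0 ≤ L - (1 / (ρ * (2 - ρ)) - Q ρ))]
      have := mul_nonneg key (exp_pos (L * ρ)).le
      nlinarith [this]
    have h5 := hmono ⟨le_rfl, hε.2⟩ ⟨hε.2, le_rfl⟩ hε.2
    simp only [hR, zero_mul] at h5
    have h6 : z ε ^ 2 + P ε ^ 2 ≤ 0 := by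
      by_contra h7
      exact absurd h5 (not_le.2 (mul_pos (not_le.1 h7) (exp_pos _)))
    nlinarith [sq_nonneg (z ε), sq_nonneg (P ε)]
  have hlim : Filter.Tendsto z (nhdsWithin 0 (Ioi 0)) (nhds (z 0)) :=
    h.continuous_z.continuousAt.tendsto.mono_left nhdsWithin_le_nhds
  have hlim' : Filter.Tendsto z (nhdsWithin 0 (Ioi 0)) (nhds 0) := by
    refine tendsto_const_nhds.congr' ?_
    filter_upwards [Ioc_mem_nhdsGT hr0] with ε hε using (hvanish ε hε).symm
  exact h.z_zero_neg.ne (tendsto_nhds_unique hlim hlim')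

theorem continuousOn_phaseSpeed : ContinuousOn (phaseSpeed Q z y P) (Icc 0 1) := by
  have := h.continuous_z
  have := h.continuous_P
  have := h.continuous_y
  have := h.continuous_Q
  unfold phaseSpeed
  exact ContinuousOn.div (by fun_prop) (by fun_prop) fun r hr => (h.normSq_pos hr).ne'

theorem continuous_phaseSpeed_clampUnit :
    Continuous fun ρ => phaseSpeed Q z y P (clampUnit ρ) :=
  h.continuousOn_phaseSpeed.comp_continuous continuous_clampUnit clampUnit_mem

theorem continuous_phase : Continuous (phase Q z y P) :=
  intervalIntegral.continuous_primitive
    (fun _ _ => h.continuous_phaseSpeed_clampUnit.intervalIntegrable _ _) 0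

theorem hasDerivAt_phase {r : ℝ} (hr : r ∈ Icc (0 : ℝ) 1) :
    HasDerivAt (phase Q z y P) (phaseSpeed Q z y P r) r := by
  have := intervalIntegral.integral_hasDerivAt_right
    (h.continuous_phaseSpeed_clampUnit.intervalIntegrable 0 r)
    (h.continuous_phaseSpeed_clampUnit.stronglyMeasurableAtFilter _ _)
    h.continuous_phaseSpeed_clampUnit.continuousAt
  rwa [clampUnit_of_mem hr] at this

theorem continuousOn_phase : ContinuousOn (phase Q z y P) (Icc 0 1) :=
  h.continuous_phase.continuousOn

theorem phaseSpeed_pos {r : ℝ} (hr : r ∈ Icc (0 : ℝ) 1) : 0 < phaseSpeed Q z y P r := by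
  refine div_pos ?_ (h.normSq_pos hr)
  rw [h.flux_eq r hr]
  have hp : 0 ≤ r * (2 - r) := mul_nonneg hr.1 (by linarith [hr.2])
  have hQ := h.Q_pos r hr
  by_cases hz : z r = 0
  · have hn := h.normSq_pos hr
    rw [h.flux_eq r hr, hz] at hn
    have h1 : r * (2 - r) * y r ≠ 0 := by rintro h2; rw [h2] at hn; simp at hn
    have h2 : y r ≠ 0 := right_ne_zero_of_mul h1
    have h3 : 0 < r * (2 - r) := lt_of_le_of_ne hp (left_ne_zero_of_mul h1).symm
    have : 0 < r * (2 - r) * y r ^ 2 := by positivity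
    rw [hz]; nlinarith
  · have h1 : 0 < Q r * z r ^ 2 := by positivity
    nlinarith [mul_nonneg hp (sq_nonneg (y r))]

theorem strictMonoOn_phase : StrictMonoOn (phase Q z y P) (Icc 0 1) := by
  refine strictMonoOn_of_deriv_pos (convex_Icc _ _) h.continuousOn_phase fun r hr => ?_
  have hr' := interior_subset hr
  rw [(h.hasDerivAt_phase hr').deriv]
  exact h.phaseSpeed_pos hr'

theorem phase_nonneg {r : ℝ} (hr : r ∈ Icc (0 : ℝ) 1) : 0 ≤ phase Q z y P r := by
  have := h.strictMonoOn_phase.monotoneOn ⟨le_rfl, zero_le_one⟩ hr hr.1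
  simpa using this

theorem phase_pos {r : ℝ} (hr : r ∈ Ioc (0 : ℝ) 1) : 0 < phase Q z y P r := by
  have := h.strictMonoOn_phase ⟨le_rfl, zero_le_one⟩ (Ioc_subset_Icc_self hr) hr.1
  simpa using this

/-- Polar coordinates in the phase plane. -/
theorem exists_polar {r : ℝ} (hr : r ∈ Icc (0 : ℝ) 1) :
    ∃ C > 0, z r = -(C * cos (phase Q z y P r)) ∧ P r = C * sin (phase Q z y P r) := by
  set ψ := phase Q z y P with hψ
  -- Rotating `(z, P)` back by the angle `ψ` gives `(-C, B)`, of constant direction.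
  set B : ℝ → ℝ := fun r => z r * sin (ψ r) + P r * cos (ψ r) with hB
  set C : ℝ → ℝ := fun r => P r * sin (ψ r) - z r * cos (ψ r) with hC
  set m : ℝ → ℝ := fun r => (z r * y r - P r * (Q r * z r)) / (z r ^ 2 + P r ^ 2) with hm
  have hBd : ∀ r ∈ Icc (0 : ℝ) 1, HasDerivAt B (B r * m r) r := by
    intro r hr
    have hn := (h.normSq_pos hr).ne'
    have hp := h.hasDerivAt_phase hr
    have := ((h.hasDerivAt_z r).mul hp.sin).add ((h.hasDerivAt_P r).mul hp.cos)
    refine this.congr_deriv ?_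
    simp only [hB, hm, phaseSpeed, ← hψ]
    field_simp
    ring
  have hCd : ∀ r ∈ Icc (0 : ℝ) 1, HasDerivAt C (C r * m r) r := by
    intro r hr
    have hn := (h.normSq_pos hr).ne'
    have hp := h.hasDerivAt_phase hr
    have := ((h.hasDerivAt_P r).mul hp.sin).sub ((h.hasDerivAt_z r).mul hp.cos)
    refine this.congr_deriv ?_
    simp only [hC, hm, phaseSpeed, ← hψ]
    field_simp
    ring
  have hsum : ∀ r, B r ^ 2 + C r ^ 2 = z r ^ 2 + P r ^ 2 := by
    intro r
    simp only [hB, hC]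
    linear_combination (z r ^ 2 + P r ^ 2) * sin_sq_add_cos_sq (ψ r)
  have hC0 : 0 < C 0 := by simp [hC, hψ, h.z_zero_neg]
  have hB0 : B 0 = 0 := by simp [hB, hψ, h.P_zero]
  have hconst : ∀ r ∈ Icc (0 : ℝ) 1, B r ^ 2 / (z r ^ 2 + P r ^ 2) = 0 := by
    intro r hr
    have hd : ∀ r ∈ Icc (0 : ℝ) 1, HasDerivAt (fun r => B r ^ 2 / (B r ^ 2 + C r ^ 2)) 0 r := by
      intro r hr
      have hn : B r ^ 2 + C r ^ 2 ≠ 0 := by rw [hsum]; exact (h.normSq_pos hr).ne'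
      have := ((hBd r hr).pow 2).div (((hBd r hr).pow 2).add ((hCd r hr).pow 2)) hn
      refine this.congr_deriv ?_
      simp only [Pi.add_apply, Pi.pow_apply]
      field_simp
      ring
    have := constant_of_has_deriv_right_zero (f := fun r => B r ^ 2 / (B r ^ 2 + C r ^ 2))
      (a := 0) (b := 1) (fun r hr => (hd r hr).continuousAt.continuousWithinAt)
      (fun r hr => (hd r (Ico_subset_Icc_self hr)).hasDerivWithinAt) r hr
    simpa [hB0, hsum] using this
  have hBz : ∀ r ∈ Icc (0 : ℝ) 1, B r = 0 := by
    intro r hr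
    have := (div_eq_zero_iff.1 (hconst r hr)).resolve_right (h.normSq_pos hr).ne'
    exact pow_eq_zero_iff (two_ne_zero) |>.1 this
  have hCne : ∀ r ∈ Icc (0 : ℝ) 1, C r ≠ 0 := by
    intro r hr h0
    have := hsum r
    rw [hBz r hr, h0] at this
    have := h.normSq_pos hr
    linarith
  have hCpos : 0 < C r := by
    by_contra hneg
    have hcont : ContinuousOn C (Icc 0 r) := fun ρ hρ =>
      (hCd ρ ⟨hρ.1, hρ.2.trans hr.2⟩).continuousAt.continuousWithinAt
    obtain ⟨ρ, hρ, h0⟩ := intermediate_value_Icc' hr.1 hcont ⟨not_lt.1 hneg, hC0.le⟩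
    exact hCne ρ ⟨hρ.1, hρ.2.trans hr.2⟩ h0
  have hb := hBz r hr
  refine ⟨C r, hCpos, ?_, ?_⟩
  · simp only [hB] at hb
    simp only [hC]
    linear_combination sin (ψ r) * hb - z r * sin_sq_add_cos_sq (ψ r)
  · simp only [hB] at hb
    simp only [hC]
    linear_combination cos (ψ r) * hb - P r * sin_sq_add_cos_sq (ψ r)

theorem sin_phase_eq_zero {r : ℝ} (hr : r ∈ Icc (0 : ℝ) 1) (hP : P r = 0) :
    sin (phase Q z y P r) = 0 := by
  obtain ⟨C, hC, -, h2⟩ := h.exists_polar hr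
  rw [hP] at h2
  exact (mul_eq_zero.1 h2.symm).resolve_left hC.ne'

end RegularSolution

/-- Just to the left of any number the cosine has a constant sign. -/
theorem exists_cos_mul_cos_pos (a : ℝ) :
    ∃ ε > 0, ∀ x ∈ Ioo (a - ε) a, ∀ y ∈ Ioo (a - ε) a, 0 < cos x * cos y := by
  by_cases ha : cos a = 0
  · refine ⟨π, pi_pos, fun x hx y hy => ?_⟩
    have e : ∀ x, cos x = sin a * sin (a - x) := by
      intro x
      have : cos x = cos (a - (a - x)) := by ring_nf
      rw [this, cos_sub, ha]; ring
    have hs : sin a ^ 2 = 1 := by have := sin_sq_add_cos_sq a; rw [ha] at this; linarith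
    have h1 : 0 < sin (a - x) := sin_pos_of_pos_of_lt_pi (by linarith [hx.2]) (by linarith [hx.1])
    have h2 : 0 < sin (a - y) := sin_pos_of_pos_of_lt_pi (by linarith [hy.2]) (by linarith [hy.1])
    rw [e x, e y]
    have : sin a * sin (a - x) * (sin a * sin (a - y)) = sin (a - x) * sin (a - y) := by
      linear_combination sin (a - x) * sin (a - y) * hs
    rw [this]; positivity
  · have h1 : ∀ᶠ x in nhds a, 0 < cos x * cos a :=
      (continuous_cos.mul continuous_const).continuousAt.eventually
        (lt_mem_nhds (mul_self_pos.2 ha))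
    obtain ⟨ε, hε, hb⟩ := Metric.eventually_nhds_iff.1 h1
    refine ⟨ε, hε, fun x hx y hy => ?_⟩
    have hx' := hb (show dist x a < ε by rw [Real.dist_eq, abs_lt]; constructor <;> linarith [hx.1, hx.2])
    have hy' := hb (show dist y a < ε by rw [Real.dist_eq, abs_lt]; constructor <;> linarith [hy.1, hy.2])
    have h2 : 0 < (cos x * cos y) * (cos a * cos a) := by
      have := mul_pos hx' hy'; linarith [this]
    exact pos_of_mul_pos_left h2 (mul_self_nonneg _)

/-- Sturm comparison for phase angles: a larger coefficient makes the phase turn faster. With the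
Wronskian `D = z₂ P₁ - z₁ P₂ = C₁ C₂ sin (ψ₂ - ψ₁)` one has `D' = (Q₂ - Q₁) z₁ z₂`, so `D`
increases while the two angles are close to each other. -/
theorem RegularSolution.phase_lt_phase {Q₁ z₁ y₁ P₁ Q₂ z₂ y₂ P₂ : ℝ → ℝ}
    (h₁ : RegularSolution Q₁ z₁ y₁ P₁) (h₂ : RegularSolution Q₂ z₂ y₂ P₂)
    (hQ : ∀ r ∈ Icc (0 : ℝ) 1, Q₁ r < Q₂ r) {r : ℝ} (hr : r ∈ Ioc (0 : ℝ) 1) :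
    phase Q₁ z₁ y₁ P₁ r < phase Q₂ z₂ y₂ P₂ r := by
  set ψ₁ := phase Q₁ z₁ y₁ P₁ with hψ₁
  set ψ₂ := phase Q₂ z₂ y₂ P₂ with hψ₂
  set D : ℝ → ℝ := fun r => z₂ r * P₁ r - z₁ r * P₂ r with hD
  have hDd : ∀ r ∈ Icc (0 : ℝ) 1, HasDerivAt D ((Q₂ r - Q₁ r) * (z₁ r * z₂ r)) r := by
    intro r hr
    refine (((h₂.hasDerivAt_z r).mul (h₁.hasDerivAt_P r)).sub
      ((h₁.hasDerivAt_z r).mul (h₂.hasDerivAt_P r))).congr_deriv ?_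
    rw [h₁.flux_eq r hr, h₂.flux_eq r hr]; ring
  have hDs : ∀ r ∈ Icc (0 : ℝ) 1, ∃ C > 0, D r = C * sin (ψ₂ r - ψ₁ r) := by
    intro r hr
    obtain ⟨C₁, hC₁, e1, e2⟩ := h₁.exists_polar hr
    obtain ⟨C₂, hC₂, e3, e4⟩ := h₂.exists_polar hr
    refine ⟨C₁ * C₂, mul_pos hC₁ hC₂, ?_⟩
    simp only [hD]
    rw [e1, e2, e3, e4, sin_sub]; ring
  have hzz : ∀ r ∈ Icc (0 : ℝ) 1, 0 < cos (ψ₁ r) * cos (ψ₂ r) → 0 < z₁ r * z₂ r := by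
    intro r hr hc
    obtain ⟨C₁, hC₁, e1, -⟩ := h₁.exists_polar hr
    obtain ⟨C₂, hC₂, e3, -⟩ := h₂.exists_polar hr
    have : z₁ r * z₂ r = C₁ * C₂ * (cos (ψ₁ r) * cos (ψ₂ r)) := by rw [e1, e3]; ring
    rw [this]; positivity
  have hDmono : ∀ a b, Icc a b ⊆ Icc (0 : ℝ) 1 →
      (∀ r ∈ Ioo a b, 0 < cos (ψ₁ r) * cos (ψ₂ r)) → StrictMonoOn D (Icc a b) := by
    intro a b hab hc
    refine strictMonoOn_of_deriv_pos (convex_Icc _ _)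
      (fun r hr => (hDd r (hab hr)).continuousAt.continuousWithinAt) fun r hr => ?_
    have hr' := hab (interior_subset hr)
    rw [interior_Icc] at hr
    rw [(hDd r hr').deriv]
    exact mul_pos (sub_pos.2 (hQ r hr')) (hzz r hr' (hc r hr))
  have hc₁ := h₁.continuousOn_phase
  have hc₂ := h₂.continuousOn_phase
  -- The two angles separate immediately after `r = 0`.
  obtain ⟨δ, hδ, hδ1, hstart⟩ : ∃ δ > 0, δ ≤ 1 ∧ ∀ r ∈ Ioc 0 δ, ψ₁ r < ψ₂ r := by
    have e1 : ∀ᶠ r in nhdsWithin 0 (Icc (0:ℝ) 1), ψ₁ r < π / 2 :=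
      (hc₁ 0 (by simp)).eventually (gt_mem_nhds (by simp [pi_pos]))
    have e2 : ∀ᶠ r in nhdsWithin 0 (Icc (0:ℝ) 1), ψ₂ r < π / 2 :=
      (hc₂ 0 (by simp)).eventually (gt_mem_nhds (by simp [pi_pos]))
    obtain ⟨δ, hδ, hb⟩ := Metric.mem_nhdsWithin_iff.1 (e1.and e2)
    have hb' : ∀ r ∈ Icc (0 : ℝ) (min (δ / 2) 1), ψ₁ r < π / 2 ∧ ψ₂ r < π / 2 := by
      intro r hr
      have h1 := hr.2.trans (min_le_left _ _)
      exact hb ⟨by rw [Metric.mem_ball, Real.dist_eq, abs_lt]; constructor <;> linarith [hr.1],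
        hr.1, hr.2.trans (min_le_right _ _)⟩
    refine ⟨min (δ / 2) 1, by positivity, min_le_right _ _, fun r hr => ?_⟩
    have hsub : Icc 0 (min (δ / 2) 1) ⊆ Icc (0 : ℝ) 1 := Icc_subset_Icc_right (min_le_right _ _)
    have hr' := hsub (Ioc_subset_Icc_self hr)
    have hm : StrictMonoOn D (Icc 0 (min (δ / 2) 1)) := by
      refine hDmono _ _ hsub fun ρ hρ => ?_
      have hρ' := hsub (Ioo_subset_Icc_self hρ)
      have h3 := hb' ρ (Ioo_subset_Icc_self hρ)
      have h4 := h₁.phase_nonneg hρ'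
      have h5 := h₂.phase_nonneg hρ'
      exact mul_pos (cos_pos_of_mem_Ioo ⟨by linarith [pi_pos], h3.1⟩)
        (cos_pos_of_mem_Ioo ⟨by linarith [pi_pos], h3.2⟩)
    have h1 := hm (show (0:ℝ) ∈ Icc 0 (min (δ / 2) 1) from ⟨le_rfl, by positivity⟩)
      (Ioc_subset_Icc_self hr) hr.1
    have hD0 : D 0 = 0 := by simp [hD, h₁.P_zero, h₂.P_zero]
    rw [hD0] at h1
    obtain ⟨C, hC, e⟩ := hDs r hr'
    rw [e] at h1
    have h2 : 0 < sin (ψ₂ r - ψ₁ r) := pos_of_mul_pos_right h1 hC.le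
    by_contra hle
    have h3 := hb' r (Ioc_subset_Icc_self hr)
    have h4 := h₁.phase_nonneg hr'
    have h5 := h₂.phase_nonneg hr'
    have h6 : sin (ψ₂ r - ψ₁ r) ≤ 0 :=
      sin_nonpos_of_nonpos_of_neg_pi_le (by linarith) (by linarith [pi_pos])
    linarith
  by_contra hcon
  -- Look at the first point where the angles meet again.
  set S := {ρ | ρ ∈ Icc δ 1 ∧ ψ₂ ρ ≤ ψ₁ ρ} with hS
  have hsubδ : Icc δ 1 ⊆ Icc (0 : ℝ) 1 := Icc_subset_Icc_left hδ.le
  have hSne : S.Nonempty := by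
    refine ⟨r, ⟨?_, hr.2⟩, not_lt.1 hcon⟩
    by_contra hlt
    exact hcon (hstart r ⟨hr.1, (not_le.1 hlt).le⟩)
  have hSclosed : IsClosed S := by
    have : IsClosed (Icc δ 1 ∩ (fun ρ => ψ₁ ρ - ψ₂ ρ) ⁻¹' Ici 0) :=
      ((hc₁.mono hsubδ).sub (hc₂.mono hsubδ)).preimage_isClosed_of_isClosed isClosed_Icc isClosed_Ici
    convert this using 1
    ext ρ; simp [hS]
  have hScomp : IsCompact S := isCompact_Icc.of_isClosed_subset hSclosed fun ρ hρ => hρ.1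
  obtain ⟨t, htS, htmin⟩ := hScomp.exists_isLeast hSne
  have ht := hsubδ htS.1
  have hbefore : ∀ ρ ∈ Ioo 0 t, ψ₁ ρ < ψ₂ ρ := by
    intro ρ hρ
    by_cases hρδ : ρ ≤ δ
    · exact hstart ρ ⟨hρ.1, hρδ⟩
    · by_contra hle
      exact absurd (htmin ⟨⟨(not_le.1 hρδ).le, hρ.2.le.trans ht.2⟩, not_lt.1 hle⟩)
        (not_le.2 hρ.2)
  have ht0 : 0 < t := hδ.trans_le htS.1.1
  have hteq : ψ₂ t = ψ₁ t := by
    refine le_antisymm htS.2 ?_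
    have hl : nhdsWithin t (Ioo 0 t) ≤ nhdsWithin t (Icc 0 1) :=
      nhdsWithin_mono _ fun ρ hρ => ⟨hρ.1.le, hρ.2.le.trans ht.2⟩
    have : (nhdsWithin t (Ioo 0 t)).NeBot := by
      rw [← mem_closure_iff_nhdsWithin_neBot, closure_Ioo ht0.ne]; exact ⟨ht0.le, le_rfl⟩
    exact le_of_tendsto_of_tendsto ((hc₁ t ht).mono_left hl) ((hc₂ t ht).mono_left hl)
      (by filter_upwards [self_mem_nhdsWithin] with ρ hρ using (hbefore ρ hρ).le)
  obtain ⟨ε, hε, hcos⟩ := exists_cos_mul_cos_pos (ψ₁ t)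
  set η := min ε π with hη
  have hη0 : 0 < η := lt_min hε pi_pos
  have e1 : ∀ᶠ ρ in nhdsWithin t (Icc (0:ℝ) 1), ψ₁ t - η < ψ₁ ρ :=
    (hc₁ t ht).eventually (lt_mem_nhds (by linarith))
  have e2 : ∀ᶠ ρ in nhdsWithin t (Icc (0:ℝ) 1), ψ₁ t - η < ψ₂ ρ :=
    (hc₂ t ht).eventually (lt_mem_nhds (by change _ < ψ₂ t; linarith))
  obtain ⟨κ, hκ, hb⟩ := Metric.mem_nhdsWithin_iff.1 (e1.and e2)
  set a := max (t - κ / 2) (t / 2) with ha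
  have hat : a < t := max_lt (by linarith) (by linarith)
  have ha0 : 0 < a := lt_of_lt_of_le (by linarith) (le_max_right _ _)
  have hnear : ∀ ρ ∈ Ico a t, ψ₁ ρ ∈ Ioo (ψ₁ t - η) (ψ₁ t) ∧ ψ₂ ρ ∈ Ioo (ψ₁ t - η) (ψ₁ t) := by
    intro ρ hρ
    have hρ1 : t - κ / 2 ≤ ρ := (le_max_left _ _).trans hρ.1
    have hρI : ρ ∈ Icc (0:ℝ) 1 := ⟨(ha0.trans_le hρ.1).le, hρ.2.le.trans ht.2⟩
    have h1 := hb (show ρ ∈ Metric.ball t κ ∩ Icc 0 1 from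
      ⟨by rw [Metric.mem_ball, Real.dist_eq, abs_lt]; constructor <;> linarith [hρ.2], hρI⟩)
    exact ⟨⟨h1.1, h₁.strictMonoOn_phase hρI ht hρ.2⟩,
      ⟨h1.2, hteq ▸ h₂.strictMonoOn_phase hρI ht hρ.2⟩⟩
  have hm : StrictMonoOn D (Icc a t) := by
    refine hDmono a t (fun ρ hρ => ⟨ha0.le.trans hρ.1, hρ.2.trans ht.2⟩) fun ρ hρ => ?_
    obtain ⟨h1, h2⟩ := hnear ρ (Ioo_subset_Ico_self hρ)
    have hle : η ≤ ε := min_le_left _ _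
    exact hcos _ ⟨by linarith [h1.1], h1.2⟩ _ ⟨by linarith [h2.1], h2.2⟩
  have hlt := hm ⟨le_rfl, hat.le⟩ ⟨hat.le, le_rfl⟩ hat
  obtain ⟨C, hC, e⟩ := hDs t ht
  obtain ⟨C', hC', e'⟩ := hDs a ⟨ha0.le, hat.le.trans ht.2⟩
  rw [e, e', hteq, sub_self, sin_zero, mul_zero] at hlt
  obtain ⟨h1, h2⟩ := hnear a ⟨le_rfl, hat⟩
  have hle : η ≤ π := min_le_right _ _
  have : 0 < sin (ψ₂ a - ψ₁ a) :=
    sin_pos_of_pos_of_lt_pi (sub_pos.2 (hbefore a ⟨ha0, hat⟩)) (by linarith [h1.1, h2.2])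
  exact absurd hlt (not_lt.2 (mul_pos hC' this).le)

/-! ### Even Legendre polynomials -/

/-- Coefficients of the even solution of Legendre's equation `((1 - s²) v')' + ν v = 0` with
`v(0) = 1`, so that `v(s) = ∑ aₖ s²ᵏ`. -/
noncomputable def legendreCoeff (ν : ℝ) : ℕ → ℝ
  | 0 => 1
  | k + 1 => legendreCoeff ν k * (2 * k * (2 * k + 1) - ν) / ((2 * k + 1) * (2 * k + 2))

/-- The even Legendre polynomial of degree `2 j`, normalized by the value `1` at the origin. -/
noncomputable def evenLegendre (j : ℕ) (s : ℝ) : ℝ :=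
  ∑ k ∈ Finset.range (j + 1), legendreCoeff (2 * j * (2 * j + 1)) k * s ^ (2 * k)

/-- The derivative of `evenLegendre j`. -/
noncomputable def evenLegendreDeriv (j : ℕ) (s : ℝ) : ℝ :=
  ∑ k ∈ Finset.range (j + 1),
    legendreCoeff (2 * j * (2 * j + 1)) k * ((2 * k : ℕ) * s ^ (2 * k - 1))

theorem hasDerivAt_evenLegendre (j : ℕ) (s : ℝ) :
    HasDerivAt (evenLegendre j) (evenLegendreDeriv j s) s :=
  HasDerivAt.fun_sum fun k _ => (hasDerivAt_pow (2 * k) s).const_mul _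

theorem evenLegendre_zero (j : ℕ) : evenLegendre j 0 = 1 := by
  rw [evenLegendre, Finset.sum_eq_single 0]
  · simp [legendreCoeff]
  · intro k _ hk; simp [hk]
  · simp

theorem evenLegendreDeriv_zero (j : ℕ) : evenLegendreDeriv j 0 = 0 := by
  refine Finset.sum_eq_zero fun k _ => ?_
  rcases Nat.eq_zero_or_pos k with rfl | hk
  · simp
  · rw [zero_pow (by omega)]; simp

theorem continuous_evenLegendreDeriv (j : ℕ) : Continuous (evenLegendreDeriv j) := by
  unfold evenLegendreDeriv; fun_prop

/-- Legendre's equation; the sum over the coefficients telescopes. -/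
theorem hasDerivAt_evenLegendre_flux (j : ℕ) (s : ℝ) :
    HasDerivAt (fun s => (1 - s ^ 2) * evenLegendreDeriv j s)
      (-(2 * j * (2 * j + 1) * evenLegendre j s)) s := by
  set ν : ℝ := 2 * j * (2 * j + 1) with hν
  have hD : HasDerivAt (evenLegendreDeriv j) (∑ k ∈ Finset.range (j + 1),
      legendreCoeff ν k * ((2 * k : ℕ) * ((2 * k - 1 : ℕ) * s ^ (2 * k - 1 - 1)))) s :=
    HasDerivAt.fun_sum fun k _ => ((hasDerivAt_pow (2 * k - 1) s).const_mul _).const_mul _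
  have h1 : HasDerivAt (fun s : ℝ => 1 - s ^ 2) (-(2 * s)) s := by
    simpa using (hasDerivAt_pow 2 s).const_sub 1
  refine (h1.mul hD).congr_deriv ?_
  rw [evenLegendre, evenLegendreDeriv, ← hν, Finset.mul_sum, Finset.mul_sum, Finset.mul_sum,
    ← sub_eq_zero, sub_neg_eq_add, ← Finset.sum_add_distrib, ← Finset.sum_add_distrib]
  set T : ℕ → ℝ := fun k => legendreCoeff ν k * ((2 * k : ℕ) * ((2 * k - 1 : ℕ) * s ^ (2 * k - 2)))
    with hT
  have hterm : ∀ k, -(2 * s) * (legendreCoeff ν k * ((2 * k : ℕ) * s ^ (2 * k - 1))) +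
      (1 - s ^ 2) * (legendreCoeff ν k * ((2 * k : ℕ) * ((2 * k - 1 : ℕ) * s ^ (2 * k - 1 - 1)))) +
      ν * (legendreCoeff ν k * s ^ (2 * k)) = T k - T (k + 1) := by
    intro k
    have e : T (k + 1) = legendreCoeff ν k * (2 * k * (2 * k + 1) - ν) * s ^ (2 * k) := by
      simp only [hT, legendreCoeff]
      rw [show 2 * (k + 1) - 1 = 2 * k + 1 by omega, show 2 * (k + 1) - 2 = 2 * k by omega]
      push_cast
      have h2 : (2 * (k : ℝ) + 1) ≠ 0 := by positivity
      have h3 : (2 * (k : ℝ) + 2) ≠ 0 := by positivity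
      field_simp
    rw [e]
    simp only [hT]
    rcases Nat.eq_zero_or_pos k with rfl | hk
    · simp [mul_comm]
    · obtain ⟨m, rfl⟩ : ∃ m, k = m + 1 := ⟨k - 1, by omega⟩
      rw [show 2 * (m + 1) - 1 - 1 = 2 * m by omega, show 2 * (m + 1) - 1 = 2 * m + 1 by omega,
        show 2 * (m + 1) - 2 = 2 * m by omega]
      push_cast
      ring
  rw [Finset.sum_congr rfl fun k _ => hterm k, Finset.sum_range_sub']
  have h0 : T 0 = 0 := by simp [hT]
  have h2 : T (j + 1) = 0 := by simp [hT, legendreCoeff, hν]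
  rw [h0, h2, sub_zero]

/-- The energy `(1 - s²) v'² + ν v²` is nondecreasing on `[0, 1]` and positive at `0`. -/
theorem evenLegendre_one_ne_zero {j : ℕ} (hj : 1 ≤ j) : evenLegendre j 1 ≠ 0 := by
  set ν : ℝ := 2 * j * (2 * j + 1) with hν
  have hj' : (1 : ℝ) ≤ j := by exact_mod_cast hj
  have hν0 : 0 < ν := by positivity
  set v := evenLegendre j with hv
  set w := evenLegendreDeriv j with hw
  -- `E = p w² + ν v²` with `p = 1 - s²`; as `p E = (p w)² + ν p v²`, its derivative away from
  -- `s = 1` only needs the derivative of the flux `p w`.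
  set E : ℝ → ℝ := fun s => ((1 - s ^ 2) * w s) ^ 2 / (1 - s ^ 2) + ν * v s ^ 2 with hE
  have hEd : ∀ s ∈ Ioo (0 : ℝ) 1, HasDerivAt E (2 * s * w s ^ 2) s := by
    intro s hs
    have hp : (1 - s ^ 2) ≠ 0 := by nlinarith [hs.1, hs.2]
    have h1 : HasDerivAt (fun s : ℝ => 1 - s ^ 2) (-(2 * s)) s := by
      simpa using (hasDerivAt_pow 2 s).const_sub 1
    refine ((((hasDerivAt_evenLegendre_flux j s).pow 2).div h1 hp).add
      (((hasDerivAt_evenLegendre j s).pow 2).const_mul ν)).congr_deriv ?_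
    simp only [Pi.pow_apply, ← hν, ← hw, ← hv]
    field_simp
    ring
  have hcv : Continuous v :=
    continuous_iff_continuousAt.2 fun s => (hasDerivAt_evenLegendre j s).continuousAt
  have hcw : Continuous w := continuous_evenLegendreDeriv j
  have hEe : E = fun s => (1 - s ^ 2) * w s ^ 2 + ν * v s ^ 2 := by
    ext s
    simp only [hE]
    by_cases hp : (1 - s ^ 2) = 0
    · simp [hp]
    · field_simp
  have hcE : Continuous E := by rw [hEe]; fun_prop
  have hmono : MonotoneOn E (Icc 0 1) := by
    refine monotoneOn_of_deriv_nonneg (convex_Icc _ _) hcE.continuousOn ?_ ?_ <;>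
      rw [interior_Icc]
    · exact fun s hs => (hEd s hs).differentiableAt.differentiableWithinAt
    · intro s hs
      rw [(hEd s hs).deriv]
      have := hs.1
      positivity
  intro h0
  have := hmono (show (0:ℝ) ∈ Icc 0 1 by simp) (show (1:ℝ) ∈ Icc 0 1 by simp) zero_le_one
  rw [hEe] at this
  simp only [h0] at this
  simp only [hv, hw, evenLegendre_zero, evenLegendreDeriv_zero] at this
  norm_num at this
  linarith

/-- The even Legendre polynomial in the variable `r = 1 - s`, normalized to be negative at
`r = 0`. -/
theorem regularSolution_evenLegendre {j : ℕ} (hj : 1 ≤ j) :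
    RegularSolution (fun _ => 2 * j * (2 * j + 1))
      (fun r => -(evenLegendre j 1 * evenLegendre j (1 - r)))
      (fun r => evenLegendre j 1 * evenLegendreDeriv j (1 - r))
      (fun r => evenLegendre j 1 * ((1 - (1 - r) ^ 2) * evenLegendreDeriv j (1 - r))) where
  hasDerivAt_z r := by
    have h1 : HasDerivAt (fun r : ℝ => 1 - r) (-1) r := (hasDerivAt_id r).const_sub 1
    exact ((((hasDerivAt_evenLegendre j (1 - r)).comp r h1).const_mul
      (evenLegendre j 1)).neg).congr_deriv (by ring)
  hasDerivAt_P r := by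
    have h1 : HasDerivAt (fun r : ℝ => 1 - r) (-1) r := (hasDerivAt_id r).const_sub 1
    exact (((hasDerivAt_evenLegendre_flux j (1 - r)).comp r h1).const_mul
      (evenLegendre j 1)).congr_deriv (by ring)
  flux_eq r _ := by ring
  continuous_y := by
    have := continuous_evenLegendreDeriv j
    fun_prop
  continuous_Q := continuous_const
  Q_pos r _ := by
    have : (1 : ℝ) ≤ j := by exact_mod_cast hj
    positivity
  z_zero_neg := by
    have := mul_self_pos.2 (evenLegendre_one_ne_zero hj)
    simpa using this

/-- The total phase of the even Legendre polynomial of degree `2 j`. -/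
noncomputable def legendrePhase (j : ℕ) : ℝ :=
  phase (fun _ => 2 * j * (2 * j + 1))
    (fun r => -(evenLegendre j 1 * evenLegendre j (1 - r)))
    (fun r => evenLegendre j 1 * evenLegendreDeriv j (1 - r))
    (fun r => evenLegendre j 1 * ((1 - (1 - r) ^ 2) * evenLegendreDeriv j (1 - r))) 1

/-- The total phases are multiples of `π`, because even polynomials have a critical point at the
equator, and they increase strictly with the degree by Sturm comparison. -/
theorem mul_pi_le_legendrePhase {j : ℕ} (hj : 1 ≤ j) : j * π ≤ legendrePhase j := by
  have hmul : ∀ j : ℕ, 1 ≤ j → ∃ m : ℤ, m * π = legendrePhase j := fun j hj =>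
    sin_eq_zero_iff.1 ((regularSolution_evenLegendre hj).sin_phase_eq_zero ⟨zero_le_one, le_rfl⟩
      (by simp [evenLegendreDeriv_zero]))
  induction j, hj using Nat.le_induction with
  | base =>
    obtain ⟨m, hm⟩ := hmul 1 le_rfl
    have hpos : 0 < legendrePhase 1 :=
      (regularSolution_evenLegendre le_rfl).phase_pos ⟨zero_lt_one, le_rfl⟩
    rw [← hm] at hpos ⊢
    have h1 : (0 : ℝ) < m := pos_of_mul_pos_left hpos pi_pos.le
    have h2 : (1 : ℤ) ≤ m := by exact_mod_cast h1
    gcongr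
    exact_mod_cast h2
  | succ j hj ih =>
    obtain ⟨m, hm⟩ := hmul (j + 1) (by omega)
    have hlt : legendrePhase j < legendrePhase (j + 1) :=
      (regularSolution_evenLegendre hj).phase_lt_phase
        (regularSolution_evenLegendre (j := j + 1) (by omega))
        (fun r _ => by push_cast; nlinarith [(Nat.cast_nonneg j : (0:ℝ) ≤ j)])
        ⟨zero_lt_one, le_rfl⟩
    rw [← hm] at hlt ⊢
    have h1 : (j : ℝ) < m := lt_of_mul_lt_mul_right (ih.trans_lt hlt) pi_pos.le
    have h2 : (j : ℤ) + 1 ≤ m := by exact_mod_cast h1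
    gcongr
    exact_mod_cast h2

/-! ### Averages over segments from the origin -/

/-- The average of `G` over the segment from `0` to `r`, written over `[0, 1]` so that it is
regular at `r = 0`. -/
noncomputable def segmentAverage (G : ℝ → ℝ) (r : ℝ) : ℝ := ∫ τ in (0 : ℝ)..1, G (r * τ)

theorem continuous_segmentAverage {G : ℝ → ℝ} (hG : Continuous G) :
    Continuous (segmentAverage G) :=
  intervalIntegral.continuous_parametric_intervalIntegral_of_continuous'
    (f := fun r τ => G (r * τ)) (by fun_prop) 0 1

theorem mul_segmentAverage (G : ℝ → ℝ) (r : ℝ) : r * segmentAverage G r = ∫ ρ in (0 : ℝ)..r, G ρ := by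
  rw [segmentAverage, intervalIntegral.mul_integral_comp_mul_left]
  simp

theorem abs_segmentAverage_le {G : ℝ → ℝ} {b r : ℝ} (hG : ∀ τ ∈ Icc (0 : ℝ) 1, |G (r * τ)| ≤ b) :
    |segmentAverage G r| ≤ b := by
  have := intervalIntegral.norm_integral_le_of_norm_le_const (a := 0) (b := 1)
    (f := fun τ => G (r * τ)) (C := b) (fun τ hτ => by
      rw [uIoc_of_le zero_le_one] at hτ
      exact hG τ (Ioc_subset_Icc_self hτ))
  simpa [segmentAverage] using this

/-- The derivative of `segmentAverage G` when `G'` is the derivative of `G`. -/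
noncomputable def segmentAverageDeriv (G' : ℝ → ℝ) (r : ℝ) : ℝ :=
  ∫ τ in (0 : ℝ)..1, G' (r * τ) * τ

theorem continuous_segmentAverageDeriv {G' : ℝ → ℝ} (hG : Continuous G') :
    Continuous (segmentAverageDeriv G') :=
  intervalIntegral.continuous_parametric_intervalIntegral_of_continuous'
    (f := fun r τ => G' (r * τ) * τ) (by fun_prop) 0 1

theorem hasDerivAt_segmentAverage {G G' : ℝ → ℝ} (hG : ∀ r, HasDerivAt G (G' r) r)
    (hG' : Continuous G') (r : ℝ) :
    HasDerivAt (segmentAverage G) (segmentAverageDeriv G' r) r := by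
  have hGc : Continuous G := continuous_iff_continuousAt.2 fun r => (hG r).continuousAt
  obtain ⟨b, hb⟩ := (isCompact_Icc (a := -(|r| + 1)) (b := |r| + 1)).exists_bound_of_continuousOn
    hG'.continuousOn
  refine (intervalIntegral.hasDerivAt_integral_of_dominated_loc_of_deriv_le
    (F := fun r τ => G (r * τ)) (F' := fun r τ => G' (r * τ) * τ) (bound := fun _ => b)
    (Metric.ball_mem_nhds r zero_lt_one) (Filter.Eventually.of_forall fun x =>
      (by fun_prop : Continuous fun τ => G (x * τ)).aestronglyMeasurable)
    ((by fun_prop : Continuous fun τ => G (r * τ)).intervalIntegrable _ _)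
    (by fun_prop : Continuous fun τ => G' (r * τ) * τ).aestronglyMeasurable
    (Filter.Eventually.of_forall fun τ hτ x hx => ?_) (by simp)
    (Filter.Eventually.of_forall fun τ _ x _ => ?_)).2
  · rw [uIoc_of_le zero_le_one] at hτ
    have hxr : |x| ≤ |r| + 1 := by
      rw [Metric.mem_ball, Real.dist_eq] at hx
      have := abs_sub_abs_le_abs_sub x r
      linarith
    have h1 : |x * τ| ≤ |r| + 1 := by
      rw [abs_mul, abs_of_pos hτ.1]
      nlinarith [abs_nonneg x, hτ.2]
    have h2 := hb (x * τ) (abs_le.1 h1)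
    rw [norm_mul, Real.norm_eq_abs τ, abs_of_pos hτ.1]
    nlinarith [norm_nonneg (G' (x * τ)), hτ.2, hτ.1]
  · have h1 : HasDerivAt (fun x : ℝ => x * τ) τ x := by
      simpa using (hasDerivAt_id x).mul_const τ
    exact (hG (x * τ)).comp x h1

theorem mul_segmentAverageDeriv {G G' : ℝ → ℝ} (hG : ∀ r, HasDerivAt G (G' r) r)
    (hG' : Continuous G') (r : ℝ) :
    r * segmentAverageDeriv G' r + segmentAverage G r = G r := by
  have hGc : Continuous G := continuous_iff_continuousAt.2 fun r => (hG r).continuousAt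
  have h1 := (hasDerivAt_id r).mul (hasDerivAt_segmentAverage hG hG' r)
  have h2 : HasDerivAt (fun r => r * segmentAverage G r) (G r) r := by
    rw [funext (mul_segmentAverage G)]
    exact intervalIntegral.integral_hasDerivAt_right (hGc.intervalIntegrable _ _)
      (hGc.stronglyMeasurableAtFilter _ _) hGc.continuousAt
  have h3 := h1.unique h2
  simp only [id, one_mul] at h3
  linarith

/-! ### The regular solution of the singular initial value problem -/

/-- The function `1 / (2 - r)` on `(-∞, 1]`, continued by the constant `1`. -/
noncomputable def weight (r : ℝ) : ℝ := (max (2 - r) 1)⁻¹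

theorem continuous_weight : Continuous weight := by
  unfold weight
  exact Continuous.inv₀ (by fun_prop) fun r => (lt_max_of_lt_right one_pos).ne'

theorem weight_of_le {r : ℝ} (hr : r ≤ 1) : weight r = (2 - r)⁻¹ := by
  rw [weight, max_eq_left (by linarith)]

theorem abs_weight_le (r : ℝ) : |weight r| ≤ 1 := by
  have h : (0 : ℝ) < max (2 - r) 1 := lt_max_of_lt_right one_pos
  rw [weight, abs_of_pos (inv_pos.2 h)]
  exact inv_le_one_of_one_le₀ (le_max_right _ _)

theorem mul_integral_exp (M a : ℝ) :
    M * (a * ∫ τ in (0 : ℝ)..1, exp (M * (a * τ))) = exp (M * a) - 1 := by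
  have h : ∀ τ ∈ uIcc (0 : ℝ) 1, HasDerivAt (fun τ => exp (M * (a * τ)))
      (M * (a * exp (M * (a * τ)))) τ := by
    intro τ _
    have h1 : HasDerivAt (fun τ : ℝ => M * (a * τ)) (M * a) τ := by
      simpa using ((hasDerivAt_id τ).const_mul a).const_mul M
    exact h1.exp.congr_deriv (by ring)
  have h2 := intervalIntegral.integral_eq_sub_of_hasDerivAt h
    ((by fun_prop : Continuous fun τ => M * (a * exp (M * (a * τ)))).intervalIntegrable _ _)
  simp only [intervalIntegral.integral_const_mul] at h2
  simpa using h2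

open BoundedContinuousFunction in
/-- Existence of the regular solution `g d` with `g d 0 = d`, and its Lipschitz dependence on `d`.
The singular equation `(r (2 - r) g')' = -c F(g)` is equivalent to the nonlocal but regular equation
`(2 - r) g' = -c · (average of F(g) over [0, r])`, which is solved by Banach's fixed point theorem
for `exp (-M |r|) g(r)`. -/
theorem exists_regular_flow {F : ℝ → ℝ} {L : NNReal} (hF : LipschitzWith L F) {b : ℝ}
    (hb : ∀ x, |F x| ≤ b) (c : ℝ) :
    ∃ (g : ℝ → ℝ → ℝ) (M : ℝ), (∀ d, g d 0 = d) ∧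
      (∀ d r, HasDerivAt (g d) (-(c * (weight r * segmentAverage (fun x => F (g d x)) r))) r) ∧
      (∀ d d' r, |g d r - g d' r| ≤ 2 * exp (M * |r|) * |d - d'|) ∧
      ∀ d, F d = 0 → ∀ r, g d r = d := by
  set M : ℝ := 2 * |c| * L + 1 with hM
  have hM0 : 0 < M := by positivity
  have hb0 : 0 ≤ b := (abs_nonneg _).trans (hb 0)
  let lift : (ℝ →ᵇ ℝ) → ℝ → ℝ := fun y r => exp (M * |r|) * y r
  have hliftc : ∀ y, Continuous (lift y) := fun y => by
    have := y.continuous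
    simp only [lift]; fun_prop
  let S : (ℝ →ᵇ ℝ) → ℝ → ℝ := fun y ρ => weight ρ * segmentAverage (fun x => F (lift y x)) ρ
  have hSc : ∀ y, Continuous (S y) := fun y =>
    continuous_weight.mul (continuous_segmentAverage (hF.continuous.comp (hliftc y)))
  have hSb : ∀ y ρ, |S y ρ| ≤ b := by
    intro y ρ
    have h1 := abs_weight_le ρ
    have h2 : |segmentAverage (fun x => F (lift y x)) ρ| ≤ b :=
      abs_segmentAverage_le fun τ _ => hb _
    rw [abs_mul]
    nlinarith [abs_nonneg (weight ρ), abs_nonneg (segmentAverage (fun x => F (lift y x)) ρ)]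
  have hSL : ∀ y₁ y₂ ρ, |S y₁ ρ - S y₂ ρ| ≤ L * dist y₁ y₂ * exp (M * |ρ|) := by
    intro y₁ y₂ ρ
    have h0 : S y₁ ρ - S y₂ ρ =
        weight ρ * segmentAverage (fun x => F (lift y₁ x) - F (lift y₂ x)) ρ := by
      simp only [S, segmentAverage]
      rw [intervalIntegral.integral_sub, mul_sub]
      · have := hF.continuous.comp (hliftc y₁)
        exact (this.comp (continuous_const.mul continuous_id)).intervalIntegrable _ _
      · have := hF.continuous.comp (hliftc y₂)
        exact (this.comp (continuous_const.mul continuous_id)).intervalIntegrable _ _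
    have h1 : |segmentAverage (fun x => F (lift y₁ x) - F (lift y₂ x)) ρ| ≤
        L * dist y₁ y₂ * exp (M * |ρ|) := by
      refine abs_segmentAverage_le fun τ hτ => ?_
      have e1 := hF.dist_le_mul (lift y₁ (ρ * τ)) (lift y₂ (ρ * τ))
      have e2 : dist (lift y₁ (ρ * τ)) (lift y₂ (ρ * τ)) =
          exp (M * |ρ * τ|) * dist (y₁ (ρ * τ)) (y₂ (ρ * τ)) := by
        simp only [lift, Real.dist_eq]
        rw [← mul_sub, abs_mul, abs_of_pos (exp_pos _)]
      have e3 : exp (M * |ρ * τ|) ≤ exp (M * |ρ|) := by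
        rw [exp_le_exp, abs_mul, abs_of_nonneg hτ.1]
        exact mul_le_mul_of_nonneg_left (mul_le_of_le_one_right (abs_nonneg _) hτ.2) hM0.le
      have e4 : dist (y₁ (ρ * τ)) (y₂ (ρ * τ)) ≤ dist y₁ y₂ :=
        BoundedContinuousFunction.dist_coe_le_dist _
      rw [Real.dist_eq (F _), e2] at e1
      calc _ ≤ _ := e1
        _ ≤ L * (exp (M * |ρ|) * dist y₁ y₂) := by gcongr
        _ = _ := by ring
    rw [h0, abs_mul]
    have := abs_weight_le ρ
    nlinarith [abs_nonneg (weight ρ),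
      abs_nonneg (segmentAverage (fun x => F (lift y₁ x) - F (lift y₂ x)) ρ)]
  -- The Picard map in weighted form.
  have hexp : ∀ r : ℝ, exp (-(M * |r|)) * exp (M * |r|) = 1 := fun r => by
    rw [← exp_add]; simp
  have hle1 : ∀ r : ℝ, exp (-(M * |r|)) ≤ 1 := fun r =>
    exp_le_one_iff.2 (by have := abs_nonneg r; nlinarith)
  let T : ℝ → (ℝ →ᵇ ℝ) → (ℝ →ᵇ ℝ) := fun d y => BoundedContinuousFunction.ofNormedAddCommGroup
    (fun r => exp (-(M * |r|)) * (d - c * (r * segmentAverage (S y) r)))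
    (by have := continuous_segmentAverage (hSc y); fun_prop) (|d| + |c| * b / M) (by
      intro r
      have h1 : |segmentAverage (S y) r| ≤ b := abs_segmentAverage_le fun τ _ => hSb y _
      have h2 : M * |r| ≤ exp (M * |r|) := by have := add_one_le_exp (M * |r|); linarith
      have h3 : exp (-(M * |r|)) * |r| ≤ 1 / M := by
        rw [le_div_iff₀ hM0]
        have := mul_le_mul_of_nonneg_left h2 (exp_pos (-(M * |r|))).le
        rw [hexp] at this
        linarith
      rw [Real.norm_eq_abs, abs_mul, abs_of_pos (exp_pos _)]
      have h4 : |d - c * (r * segmentAverage (S y) r)| ≤ |d| + |c| * (|r| * b) := by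
        refine (abs_sub _ _).trans ?_
        rw [abs_mul, abs_mul]
        gcongr
      calc _ ≤ exp (-(M * |r|)) * (|d| + |c| * (|r| * b)) := by gcongr
        _ = exp (-(M * |r|)) * |d| + |c| * b * (exp (-(M * |r|)) * |r|) := by ring
        _ ≤ 1 * |d| + |c| * b * (1 / M) := by gcongr; exact hle1 r
        _ = _ := by ring)
  have hT : ∀ d y r, T d y r = exp (-(M * |r|)) * (d - c * (r * segmentAverage (S y) r)) :=
    fun _ _ _ => rfl
  have hcontr : ∀ d, ContractingWith (1 / 2) (T d) := by
    intro d
    refine ⟨by norm_num, LipschitzWith.of_dist_le_mul fun y₁ y₂ => ?_⟩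
    rw [BoundedContinuousFunction.dist_le (by positivity)]
    intro r
    have hsub : segmentAverage (S y₁) r - segmentAverage (S y₂) r =
        ∫ τ in (0 : ℝ)..1, (S y₁ (r * τ) - S y₂ (r * τ)) := by
      simp only [segmentAverage]
      rw [intervalIntegral.integral_sub]
      · exact ((hSc y₁).comp (continuous_const.mul continuous_id)).intervalIntegrable _ _
      · exact ((hSc y₂).comp (continuous_const.mul continuous_id)).intervalIntegrable _ _
    have hint : |segmentAverage (S y₁) r - segmentAverage (S y₂) r| ≤
        L * dist y₁ y₂ * ∫ τ in (0 : ℝ)..1, exp (M * (|r| * τ)) := by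
      rw [hsub, ← intervalIntegral.integral_const_mul]
      refine intervalIntegral.norm_integral_le_of_norm_le (μ := MeasureTheory.volume)
        (f := fun τ => S y₁ (r * τ) - S y₂ (r * τ))
        (g := fun τ => L * dist y₁ y₂ * exp (M * (|r| * τ))) zero_le_one
        (Filter.Eventually.of_forall fun τ hτ => ?_)
        ((by fun_prop : Continuous fun τ =>
          L * dist y₁ y₂ * exp (M * (|r| * τ))).intervalIntegrable _ _)
      have := hSL y₁ y₂ (r * τ)
      rwa [abs_mul r, abs_of_pos hτ.1] at this
    have hexpint := mul_integral_exp M |r|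
    set I := ∫ τ in (0 : ℝ)..1, exp (M * (|r| * τ)) with hI
    have h1 : exp (-(M * |r|)) * (M * (|r| * I)) ≤ 1 := by
      rw [hexpint, mul_sub, hexp]
      have := exp_pos (-(M * |r|)); linarith
    have h2 : dist (T d y₁ r) (T d y₂ r) =
        exp (-(M * |r|)) * (|c| * (|r| * |segmentAverage (S y₁) r - segmentAverage (S y₂) r|)) := by
      have : exp (-(M * |r|)) * (d - c * (r * segmentAverage (S y₁) r)) -
          exp (-(M * |r|)) * (d - c * (r * segmentAverage (S y₂) r)) =
          -(exp (-(M * |r|)) * (c * (r * (segmentAverage (S y₁) r - segmentAverage (S y₂) r)))) := by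
        ring
      rw [Real.dist_eq, hT, hT, this, abs_neg, abs_mul, abs_mul, abs_mul, abs_of_pos (exp_pos _)]
    have h3 : exp (-(M * |r|)) * (|r| * I) ≤ 1 / M := by
      rw [le_div_iff₀ hM0]; linarith
    have h4 : |c| * L * (1 / M) ≤ 1 / 2 := by
      rw [mul_one_div, div_le_iff₀ hM0, hM]; linarith
    rw [h2]
    calc _ ≤ exp (-(M * |r|)) * (|c| * (|r| * (L * dist y₁ y₂ * I))) := by gcongr
      _ = |c| * L * (exp (-(M * |r|)) * (|r| * I)) * dist y₁ y₂ := by ring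
      _ ≤ |c| * L * (1 / M) * dist y₁ y₂ := by gcongr
      _ ≤ 1 / 2 * dist y₁ y₂ := by gcongr
      _ = _ := by simp
  let Y : ℝ → (ℝ →ᵇ ℝ) := fun d => ContractingWith.fixedPoint (T d) (hcontr d)
  have hY : ∀ d r, lift (Y d) r = d - c * (r * segmentAverage (S (Y d)) r) := by
    intro d r
    have h1 : T d (Y d) = Y d := (hcontr d).fixedPoint_isFixedPt
    have h2 : lift (Y d) r = exp (M * |r|) * T d (Y d) r := by rw [h1]
    rw [h2, hT, ← mul_assoc, mul_comm (exp (M * |r|)), hexp, one_mul]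
  refine ⟨fun d => lift (Y d), M, fun d => by simp [hY], fun d r => ?_, fun d d' r => ?_,
    fun d hd r => ?_⟩
  · have h1 : lift (Y d) = fun r => d - c * ∫ ρ in (0 : ℝ)..r, S (Y d) ρ := by
      ext r; rw [hY, mul_segmentAverage]
    have h2 := ((intervalIntegral.integral_hasDerivAt_right
      ((hSc (Y d)).intervalIntegrable 0 r) ((hSc (Y d)).stronglyMeasurableAtFilter _ _)
      (hSc (Y d)).continuousAt).const_mul c).const_sub d
    rw [← h1] at h2
    exact h2
  · have h1 : dist (Y d) (Y d') ≤ |d - d'| / (1 - ((1 / 2 : NNReal) : ℝ)) := by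
      refine (hcontr d).fixedPoint_lipschitz_in_map (hcontr d') fun y => ?_
      rw [BoundedContinuousFunction.dist_le (abs_nonneg _)]
      intro ρ
      have : exp (-(M * |ρ|)) * (d - c * (ρ * segmentAverage (S y) ρ)) -
          exp (-(M * |ρ|)) * (d' - c * (ρ * segmentAverage (S y) ρ)) =
          exp (-(M * |ρ|)) * (d - d') := by ring
      rw [Real.dist_eq, hT, hT, this, abs_mul, abs_of_pos (exp_pos _)]
      exact mul_le_of_le_one_left (abs_nonneg _) (hle1 ρ)
    have h2 : dist (Y d r) (Y d' r) ≤ dist (Y d) (Y d') :=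
      BoundedContinuousFunction.dist_coe_le_dist _
    have h3 : |d - d'| / (1 - ((1 / 2 : NNReal) : ℝ)) = 2 * |d - d'| := by
      push_cast; ring
    simp only [lift]
    rw [← mul_sub, abs_mul, abs_of_pos (exp_pos _), ← Real.dist_eq (Y d r)]
    have h4 := exp_pos (M * |r|)
    nlinarith
  · -- A zero `d` of `F` is a constant solution.
    let y₀ : ℝ →ᵇ ℝ := BoundedContinuousFunction.ofNormedAddCommGroup
      (fun r => exp (-(M * |r|)) * d) (by fun_prop) |d| fun r => by
        rw [Real.norm_eq_abs, abs_mul, abs_of_pos (exp_pos _)]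
        exact mul_le_of_le_one_left (abs_nonneg _) (hle1 r)
    have h0 : ∀ r, lift y₀ r = d := fun r => by
      change exp (M * |r|) * (exp (-(M * |r|)) * d) = d
      rw [← mul_assoc, mul_comm (exp (M * |r|)), hexp, one_mul]
    have hS0 : S y₀ = fun _ => 0 := by
      ext r; simp [S, h0, hd, segmentAverage]
    have h1 : T d y₀ = y₀ := by
      ext r
      rw [hT, hS0]
      simp [segmentAverage, y₀]
    have h2 : y₀ = Y d := (hcontr d).fixedPoint_unique h1
    change lift (Y d) r = d
    rw [← h2, h0]

/-! ### The nonlinear profile equation -/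

/-- A smooth cutoff, equal to `1` on `[-2, 2]`. -/
noncomputable def cutoff : ContDiffBump (0 : ℝ) := ⟨2, 3, by norm_num, by norm_num⟩

theorem cutoff_of_abs_le {x : ℝ} (hx : |x| ≤ 2) : cutoff x = 1 :=
  cutoff.one_of_mem_closedBall (by simpa [cutoff] using hx)

/-- The nonlinearity `x⁵ - x`, cut off smoothly outside `[-2, 2]`. -/
noncomputable def nonlin (x : ℝ) : ℝ := cutoff x * (x ^ 5 - x)

/-- The quotient of `nonlin x` by `x - 1`. -/
noncomputable def nonlinQuot (x : ℝ) : ℝ := cutoff x * (x * (x + 1) * (x ^ 2 + 1))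

theorem nonlin_eq (x : ℝ) : nonlin x = nonlinQuot x * (x - 1) := by
  unfold nonlin nonlinQuot; ring

theorem contDiff_nonlin : ContDiff ℝ 1 nonlin :=
  cutoff.contDiff.mul (by fun_prop)

theorem continuous_nonlinQuot : Continuous nonlinQuot :=
  cutoff.continuous.mul (by fun_prop)

theorem hasCompactSupport_nonlin : HasCompactSupport nonlin :=
  cutoff.hasCompactSupport.mul_right

theorem nonlin_of_abs_le {x : ℝ} (hx : |x| ≤ 2) : nonlin x = x ^ 5 - x := by
  rw [nonlin, cutoff_of_abs_le hx, one_mul]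

theorem nonlinQuot_of_abs_le {x : ℝ} (hx : |x| ≤ 2) :
    nonlinQuot x = x * (x + 1) * (x ^ 2 + 1) := by
  rw [nonlinQuot, cutoff_of_abs_le hx, one_mul]

/-- A potential of the truncated nonlinearity. -/
noncomputable def potential (x : ℝ) : ℝ := ∫ t in (0 : ℝ)..x, nonlin t

theorem hasDerivAt_potential (x : ℝ) : HasDerivAt potential (nonlin x) x :=
  intervalIntegral.integral_hasDerivAt_right (contDiff_nonlin.continuous.intervalIntegrable _ _)
    (contDiff_nonlin.continuous.stronglyMeasurableAtFilter _ _) contDiff_nonlin.continuous.continuousAt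

theorem potential_eq {x : ℝ} (hx : x ∈ Icc (0 : ℝ) 2) : potential x = x ^ 6 / 6 - x ^ 2 / 2 := by
  have h : ∀ t ∈ uIcc 0 x, HasDerivAt (fun t : ℝ => t ^ 6 / 6 - t ^ 2 / 2) (nonlin t) t := by
    intro t ht
    rw [uIcc_of_le hx.1] at ht
    rw [nonlin_of_abs_le (by rw [abs_of_nonneg ht.1]; exact ht.2.trans hx.2)]
    exact (((hasDerivAt_pow 6 t).div_const 6).sub ((hasDerivAt_pow 2 t).div_const 2)).congr_deriv
      (by push_cast; ring)
  rw [potential, intervalIntegral.integral_eq_sub_of_hasDerivAt h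
    (contDiff_nonlin.continuous.intervalIntegrable _ _)]
  ring

/-- A regular solution of `(r (2 - r) g')' = -c F(g)` with `g(0) = d`, where `F` is the truncated
nonlinearity. The variable `r = 1 - s` is the distance of the latitude `s` from the pole `s = 1`;
`y` is the derivative and `P` the flux of `g`. At `r = 1` the second derivative is not required
to be two-sided. -/
structure IsProfile (c d : ℝ) (g y P : ℝ → ℝ) : Prop where
  hasDerivAt_g : ∀ r, HasDerivAt g (y r) r
  hasDerivAt_P : ∀ r, HasDerivAt P (-(c * nonlin (g r))) r
  flux_eq : ∀ r ≤ 1, P r = r * (2 - r) * y r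
  continuous_y : Continuous y
  g_zero : g 0 = d
  exists_deriv2 : ∃ w : ℝ → ℝ, Continuous w ∧ (∀ r < 1, HasDerivAt y (w r) r) ∧
    ∀ r ≤ 1, r * (2 - r) * w r + 2 * (1 - r) * y r = -(c * nonlin (g r))

namespace IsProfile

variable {c d : ℝ} {g y P : ℝ → ℝ} (h : IsProfile c d g y P)
include h

theorem continuous_g : Continuous g :=
  continuous_iff_continuousAt.2 fun r => (h.hasDerivAt_g r).continuousAt

/-- The energy `r (2 - r) y² / 2 + c potential(g)` is nonincreasing. -/
theorem potential_le (hc : 0 < c) {r : ℝ} (hr : r ∈ Icc (0 : ℝ) 1) :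
    potential (g r) ≤ potential d := by
  set E : ℝ → ℝ := fun r => P r ^ 2 / (2 * (r * (2 - r))) + c * potential (g r) with hE
  have hEd : ∀ r ∈ Ioo (0 : ℝ) 1, HasDerivAt E (-((1 - r) * y r ^ 2)) r := by
    intro r hr
    have h1 : HasDerivAt (fun r : ℝ => 2 * (r * (2 - r))) (2 * (2 - 2 * r)) r :=
      (((hasDerivAt_id r).mul ((hasDerivAt_id r).const_sub 2)).const_mul 2).congr_deriv
        (by simp only [id]; ring)
    have h2 : (2 - r) ≠ 0 := by linarith [hr.2]
    have h3 : r ≠ 0 := hr.1.ne'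
    refine ((((h.hasDerivAt_P r).pow 2).div h1 (by positivity)).add
      (((hasDerivAt_potential (g r)).comp r (h.hasDerivAt_g r)).const_mul c)).congr_deriv ?_
    simp only [Pi.pow_apply, h.flux_eq r hr.2.le]
    field_simp
    ring
  have hEe : EqOn E (fun r => r * (2 - r) * y r ^ 2 / 2 + c * potential (g r)) (Icc 0 1) := by
    intro r hr
    simp only [hE, h.flux_eq r hr.2]
    have h2 : (2 - r) ≠ 0 := by linarith [hr.2]
    by_cases h3 : r = 0
    · simp [h3]
    · field_simp
  have hcE : ContinuousOn E (Icc 0 1) := by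
    refine ContinuousOn.congr (Continuous.continuousOn ?_) hEe
    have h1 := h.continuous_y
    have h2 := h.continuous_g
    have h3 : Continuous potential :=
      continuous_iff_continuousAt.2 fun x => (hasDerivAt_potential x).continuousAt
    fun_prop
  have hanti : AntitoneOn E (Icc 0 1) := by
    refine antitoneOn_of_deriv_nonpos (convex_Icc _ _) hcE ?_ ?_ <;> rw [interior_Icc]
    · exact fun r hr => (hEd r hr).differentiableAt.differentiableWithinAt
    · intro r hr
      rw [(hEd r hr).deriv]
      have := mul_nonneg (sub_nonneg.2 hr.2.le) (sq_nonneg (y r))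
      linarith
  have h1 := hanti (show (0 : ℝ) ∈ Icc 0 1 by simp) hr hr.1
  rw [hEe hr, hEe (by simp : (0 : ℝ) ∈ Icc (0:ℝ) 1)] at h1
  simp only [h.g_zero, zero_mul, zero_div, zero_add] at h1
  have h2 : 0 ≤ r * (2 - r) * y r ^ 2 / 2 := by
    have := mul_nonneg hr.1 (by linarith [hr.2] : 0 ≤ 2 - r)
    positivity
  exact le_of_mul_le_mul_left (by linarith) hc

/-- A profile starting in `(0, 1)` stays in the potential well. -/
theorem mem_Ioo (hc : 0 < c) (hd : d ∈ Ioo (0 : ℝ) 1) {r : ℝ} (hr : r ∈ Icc (0 : ℝ) 1) :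
    g r ∈ Ioo (0 : ℝ) (3 / 2) := by
  have hneg : potential d < 0 := by
    rw [potential_eq ⟨hd.1.le, by linarith [hd.2]⟩]
    have h2 : d ^ 2 < 1 := by nlinarith [hd.1, hd.2]
    have h4 : d ^ 6 ≤ d ^ 2 := pow_le_pow_of_le_one hd.1.le hd.2.le (by norm_num)
    have := pow_pos hd.1 2
    linarith
  have hsub : Icc 0 r ⊆ Icc (0 : ℝ) 1 := Icc_subset_Icc_right hr.2
  have hcont : ContinuousOn g (Icc 0 r) := h.continuous_g.continuousOn
  constructor
  · by_contra hcon
    obtain ⟨ρ, hρ, h0⟩ := intermediate_value_Icc' hr.1 hcont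
      (show (0 : ℝ) ∈ Icc (g r) (g 0) from ⟨not_lt.1 hcon, by rw [h.g_zero]; exact hd.1.le⟩)
    have h1 := h.potential_le hc (hsub hρ)
    rw [h0, potential_eq (by norm_num)] at h1
    norm_num at h1
    linarith
  · by_contra hcon
    obtain ⟨ρ, hρ, h0⟩ := intermediate_value_Icc hr.1 hcont
      (show (3 / 2 : ℝ) ∈ Icc (g 0) (g r) from
        ⟨by rw [h.g_zero]; linarith [hd.2], not_lt.1 hcon⟩)
    have h1 := h.potential_le hc (hsub hρ)
    rw [h0, potential_eq (by norm_num)] at h1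
    norm_num at h1
    linarith

theorem abs_g_le (hc : 0 < c) (hd : d ∈ Ioo (0 : ℝ) 1) {r : ℝ} (hr : r ∈ Icc (0 : ℝ) 1) :
    |g r| ≤ 2 := by
  have := h.mem_Ioo hc hd hr
  rw [abs_of_pos this.1]
  linarith [this.2]

/-- The deviation of a profile from the constant solution `1` solves a linear equation whose
coefficient depends on the profile. -/
theorem regularSolution (hc : 0 < c) (hd : d ∈ Ioo (0 : ℝ) 1) :
    RegularSolution (fun r => c * nonlinQuot (g r)) (fun r => g r - 1) y P where
  hasDerivAt_z r := (h.hasDerivAt_g r).sub_const 1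
  hasDerivAt_P r := (h.hasDerivAt_P r).congr_deriv (by rw [nonlin_eq]; ring)
  flux_eq r hr := h.flux_eq r hr.2
  continuous_y := h.continuous_y
  continuous_Q := continuous_const.mul (continuous_nonlinQuot.comp h.continuous_g)
  Q_pos r hr := by
    have h1 := (h.mem_Ioo hc hd hr).1
    rw [nonlinQuot_of_abs_le (h.abs_g_le hc hd hr)]
    positivity
  z_zero_neg := by rw [h.g_zero]; linarith [hd.2]

end IsProfile

/-- The profiles for all initial values, with their joint regularity. -/
theorem exists_profile_family (c : ℝ) : ∃ (g y P : ℝ → ℝ → ℝ) (K : ℝ), 0 < K ∧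
    (∀ d, IsProfile c d (g d) (y d) (P d)) ∧
    Continuous (fun p : ℝ × ℝ => g p.1 p.2) ∧ Continuous (fun p : ℝ × ℝ => y p.1 p.2) ∧
    Continuous (fun p : ℝ × ℝ => P p.1 p.2) ∧
    (∀ d, ∀ r ∈ Icc (0 : ℝ) 1, |g d r| ≤ K * |d|) ∧
    (∀ d, ∀ r ∈ Icc (0 : ℝ) 1, |g d r - 1| ≤ K * |d - 1|) := by
  obtain ⟨L, hL⟩ := contDiff_nonlin.lipschitzWith_of_hasCompactSupport hasCompactSupport_nonlin
    one_ne_zero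
  obtain ⟨b, hb⟩ := hasCompactSupport_nonlin.exists_bound_of_continuous contDiff_nonlin.continuous
  obtain ⟨g, M, hg0, hgd, hlip, hconst⟩ := exists_regular_flow hL hb c
  have hFc : Continuous nonlin := contDiff_nonlin.continuous
  have hgc : ∀ d, Continuous (g d) := fun d =>
    continuous_iff_continuousAt.2 fun r => (hgd d r).continuousAt
  have hG : Continuous (fun p : ℝ × ℝ => g p.1 p.2) := by
    rw [continuous_iff_continuousAt]
    rintro ⟨d, r⟩
    refine tendsto_iff_dist_tendsto_zero.2 (squeeze_zero (fun _ => dist_nonneg)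
      (g := fun p : ℝ × ℝ => 2 * exp (M * |p.2|) * |p.1 - d| + |g d p.2 - g d r|) ?_ ?_)
    · rintro ⟨d', r'⟩
      rw [Real.dist_eq]
      have h1 := hlip d' d r'
      have h2 := abs_sub_le (g d' r') (g d r') (g d r)
      simp only
      linarith
    · have := hgc d
      have h1 : Continuous fun p : ℝ × ℝ =>
        2 * exp (M * |p.2|) * |p.1 - d| + |g d p.2 - g d r| := by fun_prop
      have h2 := h1.tendsto (d, r)
      simpa using h2
  have hA : Continuous (fun p : ℝ × ℝ => segmentAverage (fun x => nonlin (g p.1 x)) p.2) :=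
    intervalIntegral.continuous_parametric_intervalIntegral_of_continuous'
      (f := fun (p : ℝ × ℝ) τ => nonlin (g p.1 (p.2 * τ)))
      (hFc.comp (hG.comp (by fun_prop : Continuous fun q : (ℝ × ℝ) × ℝ => (q.1.1, q.1.2 * q.2))))
      0 1
  have hW := continuous_weight
  have hy : Continuous fun p : ℝ × ℝ =>
      -(c * (weight p.2 * segmentAverage (fun x => nonlin (g p.1 x)) p.2)) := by fun_prop
  have hK : ∀ r ∈ Icc (0 : ℝ) 1, 2 * exp (M * |r|) ≤ 2 * exp |M| := by
    intro r hr
    have h1 : M * |r| ≤ |M| := by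
      rw [abs_of_nonneg hr.1]
      exact (mul_le_mul_of_nonneg_right (le_abs_self M) hr.1).trans
        (mul_le_of_le_one_right (abs_nonneg _) hr.2)
    have := exp_le_exp.2 h1
    linarith
  refine ⟨g, fun d r => -(c * (weight r * segmentAverage (fun x => nonlin (g d x)) r)),
    fun d r => -(c * (r * segmentAverage (fun x => nonlin (g d x)) r)), 2 * exp |M|, by positivity,
    fun d => ?_, hG, hy, by fun_prop, fun d r hr => ?_, fun d r hr => ?_⟩
  · have hyd : Continuous fun r => -(c * (weight r * segmentAverage (fun x => nonlin (g d x)) r)) :=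
      hy.comp (by fun_prop : Continuous fun r : ℝ => (d, r))
    have hFg := hFc.comp (hgc d)
    set G' : ℝ → ℝ := fun r => deriv nonlin (g d r) *
      -(c * (weight r * segmentAverage (fun x => nonlin (g d x)) r)) with hG'
    have hFd : ∀ r, HasDerivAt (fun x => nonlin (g d x)) (G' r) r := fun r =>
      ((contDiff_nonlin.differentiable one_ne_zero _).hasDerivAt).comp r (hgd d r)
    have hG'c : Continuous G' :=
      ((contDiff_nonlin.continuous_deriv le_rfl).comp (hgc d)).mul hyd
    refine ⟨hgd d, fun r => ?_, fun r hr => ?_, hyd, hg0 d,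
      fun r => -(c * (weight r ^ 2 * segmentAverage (fun x => nonlin (g d x)) r +
        weight r * segmentAverageDeriv G' r)), ?_, fun r hr => ?_, fun r hr => ?_⟩
    · have h1 : (fun r => -(c * (r * segmentAverage (fun x => nonlin (g d x)) r))) =
          fun r => -(c * ∫ ρ in (0 : ℝ)..r, nonlin (g d ρ)) := by
        ext r; rw [mul_segmentAverage]
      beta_reduce
      rw [h1]
      exact ((intervalIntegral.integral_hasDerivAt_right (hFg.intervalIntegrable 0 r)
        (hFg.stronglyMeasurableAtFilter _ _) hFg.continuousAt).const_mul c).neg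
    · have h2 : (2 - r) ≠ 0 := by linarith
      simp only [weight_of_le hr]
      field_simp
    · have h1 := continuous_segmentAverage hFg
      have h2 := continuous_segmentAverageDeriv hG'c
      exact ((continuous_const.mul (((hW.pow 2).mul h1).add (hW.mul h2)))).neg
    · have h2 : (2 - r) ≠ 0 := by linarith
      have h3 : HasDerivAt (fun r : ℝ => (2 - r)⁻¹) ((2 - r)⁻¹ ^ 2) r := by
        refine (((hasDerivAt_id r).const_sub 2).inv h2).congr_deriv ?_
        simp
      have h4 := ((h3.mul (hasDerivAt_segmentAverage hFd hG'c r)).const_mul c).neg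
      simp only [weight_of_le hr.le]
      refine h4.congr_of_eventuallyEq ?_
      filter_upwards [Iio_mem_nhds hr] with x hx
      simp [weight_of_le hx.le]
    · have h1 := mul_segmentAverageDeriv hFd hG'c r
      have h2 : (2 - r) ≠ 0 := by linarith
      simp only [weight_of_le hr]
      rw [← h1]
      field_simp
      ring
  · have h1 := hlip d 0 r
    rw [hconst 0 (by simp [nonlin]), sub_zero, sub_zero] at h1
    exact h1.trans (mul_le_mul_of_nonneg_right (hK r hr) (abs_nonneg _))
  · have h1 := hlip d 1 r
    rw [hconst 1 (by simp [nonlin])] at h1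
    exact h1.trans (mul_le_mul_of_nonneg_right (hK r hr) (abs_nonneg _))

/-! ### Shooting -/

/-- Shooting in the initial value: the phase at the equator is small for `d` near `0`, exceeds `n π`
for `d` near `1` by comparison with the Legendre polynomial of degree `2 n`, and is continuous. -/
theorem exists_profile_phase_eq {c : ℝ} {n k : ℕ} (hn : 1 ≤ n)
    (hc : 2 * (n : ℝ) * (2 * n + 1) < 4 * c) (hk : 1 ≤ k) (hkn : k ≤ n) :
    ∃ d ∈ Ioo (0 : ℝ) 1, ∃ g y P : ℝ → ℝ, IsProfile c d g y P ∧
      phase (fun r => c * nonlinQuot (g r)) (fun r => g r - 1) y P 1 = k * π := by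
  have hc0 : 0 < c := by
    have : (0 : ℝ) ≤ 2 * n * (2 * n + 1) := by positivity
    linarith
  obtain ⟨g, y, P, K, hK, hprof, hg, hy, hP, hsmall, hnear⟩ := exists_profile_family c
  have hreg : ∀ d : Ioo (0 : ℝ) 1, RegularSolution (fun r => c * nonlinQuot (g d r))
      (fun r => g d r - 1) (y d) (P d) := fun d => (hprof d).regularSolution hc0 d.2
  set Φ : Ioo (0 : ℝ) 1 → ℝ := fun d =>
    phase (fun r => c * nonlinQuot (g d r)) (fun r => g d r - 1) (y d) (P d) 1 with hΦ
  have hΦc : Continuous Φ := by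
    refine intervalIntegral.continuous_parametric_intervalIntegral_of_continuous'
      (f := fun (d : Ioo (0 : ℝ) 1) ρ => phaseSpeed (fun r => c * nonlinQuot (g d r))
        (fun r => g d r - 1) (y d) (P d) (clampUnit ρ)) ?_ 0 1
    have hι : Continuous fun q : Ioo (0 : ℝ) 1 × ℝ => ((q.1 : ℝ), clampUnit q.2) := by
      have := continuous_clampUnit
      fun_prop
    have h1 := hg.comp hι
    have h2 := hy.comp hι
    have h3 := hP.comp hι
    have h4 := continuous_nonlinQuot.comp h1
    exact Continuous.div (((continuous_const.mul h4).mul ((h1.sub continuous_const).pow 2)).add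
      (h2.mul h3)) (((h1.sub continuous_const).pow 2).add (h3.pow 2))
      fun q => ((hreg q.1).normSq_pos (clampUnit_mem q.2)).ne'
  -- Near `d = 0` the profile does not reach the value `1`.
  obtain ⟨d₀, hd₀⟩ : ∃ d : Ioo (0 : ℝ) 1, Φ d < π := by
    have hd : min (1 / 2) (1 / (2 * K)) ∈ Ioo (0 : ℝ) 1 :=
      ⟨by positivity, (min_le_left _ _).trans_lt (by norm_num)⟩
    refine ⟨⟨_, hd⟩, ?_⟩
    by_contra hcon
    have hr := hreg ⟨_, hd⟩
    obtain ⟨r, hr1, hr2⟩ := intermediate_value_Icc zero_le_one hr.continuousOn_phase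
      (show π ∈ Icc _ _ from ⟨by rw [phase_zero]; exact pi_pos.le, not_lt.1 hcon⟩)
    obtain ⟨C, hC, hz, -⟩ := hr.exists_polar hr1
    rw [hr2, cos_pi] at hz
    have h1 := hsmall (min (1 / 2) (1 / (2 * K))) r hr1
    rw [abs_of_pos hd.1] at h1
    have h2 : K * min (1 / 2) (1 / (2 * K)) ≤ K * (1 / (2 * K)) := by
      gcongr; exact min_le_right _ _
    have h3 : K * (1 / (2 * K)) = 1 / 2 := by field_simp
    have h4 := le_abs_self (g (min (1 / 2) (1 / (2 * K))) r)
    linarith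
  -- Near `d = 1` the equation is close to Legendre's equation with parameter `4 c`.
  obtain ⟨d₁, hd₁⟩ : ∃ d : Ioo (0 : ℝ) 1, n * π ≤ Φ d := by
    have hlim : ∀ᶠ x in nhds (1 : ℝ), 2 * (n : ℝ) * (2 * n + 1) < c * nonlinQuot x := by
      have hcont : Continuous fun x => c * nonlinQuot x :=
        continuous_const.mul continuous_nonlinQuot
      refine hcont.continuousAt.eventually (lt_mem_nhds ?_)
      beta_reduce
      rw [nonlinQuot_of_abs_le (x := 1) (by norm_num)]
      linarith
    obtain ⟨δ, hδ, hball⟩ := Metric.eventually_nhds_iff.1 hlim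
    set ε := min (1 / 2) (δ / (2 * K)) with hε
    have hε0 : 0 < ε := by positivity
    have hd : 1 - ε ∈ Ioo (0 : ℝ) 1 :=
      ⟨by have : ε ≤ 1 / 2 := min_le_left _ _; linarith, by linarith⟩
    refine ⟨⟨_, hd⟩, (mul_pi_le_legendrePhase hn).trans ?_⟩
    refine ((regularSolution_evenLegendre hn).phase_lt_phase (hreg ⟨_, hd⟩) (fun r hr => ?_)
      ⟨zero_lt_one, le_rfl⟩).le
    refine hball ?_
    rw [Real.dist_eq]
    refine (hnear _ r hr).trans_lt ?_
    have h1 : |1 - ε - 1| = ε := by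
      rw [show 1 - ε - 1 = -ε by ring, abs_neg, abs_of_pos hε0]
    have h2 : K * ε ≤ K * (δ / (2 * K)) := by gcongr; exact min_le_right _ _
    have h3 : K * (δ / (2 * K)) = δ / 2 := by field_simp
    simp only [h1]
    linarith
  have : PreconnectedSpace (Ioo (0 : ℝ) 1) := Subtype.preconnectedSpace isPreconnected_Ioo
  have hk1 : (1 : ℝ) ≤ k := by exact_mod_cast hk
  have hk2 : (k : ℝ) ≤ n := by exact_mod_cast hkn
  obtain ⟨d, hd⟩ := intermediate_value_univ d₀ d₁ hΦc
    (show (k : ℝ) * π ∈ Icc _ _ from ⟨by nlinarith [pi_pos], by nlinarith [pi_pos]⟩)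
  exact ⟨d, d.2, g d, y d, P d, hprof d, hd⟩

/-! ### Counting local maxima -/

theorem sin_pos_of_mem_phase {m : ℕ} {x : ℝ} (h1 : 2 * m * π < x) (h2 : x < (2 * m + 1) * π) :
    0 < sin x := by
  rw [← sin_sub_nat_mul_two_pi x m]
  exact sin_pos_of_pos_of_lt_pi (by linarith) (by linarith)

theorem sin_neg_of_mem_phase {m : ℕ} {x : ℝ} (h1 : (2 * m + 1) * π < x)
    (h2 : x < (2 * m + 2) * π) : sin x < 0 := by
  rw [← neg_pos, ← sin_sub_pi]
  exact sin_pos_of_mem_phase (m := m) (by linarith) (by linarith)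

/-- If the derivative of `u` has the sign of `sin Ψ` for a phase `Ψ` increasing from `0` to `2 k π`,
then `u` has exactly `k` interior local maxima: the points with `Ψ = π, 3 π, …, (2 k - 1) π`. -/
theorem encard_isLocalMax_eq {b : ℝ} (hb : 0 < b) {u u' Ψ : ℝ → ℝ} {k : ℕ}
    (hu : ∀ θ, HasDerivAt u (u' θ) θ) (hΨc : ContinuousOn Ψ (Icc 0 b))
    (hΨm : StrictMonoOn Ψ (Icc 0 b)) (hΨ0 : Ψ 0 = 0) (hΨb : Ψ b = 2 * k * π)
    (hsign : ∀ θ ∈ Ioo 0 b, ∃ C > 0, u' θ = C * sin (Ψ θ)) :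
    {θ : ℝ | θ ∈ Ioo 0 b ∧ IsLocalMax u θ}.encard = (k : ℕ∞) := by
  have huc : Continuous u := continuous_iff_continuousAt.2 fun θ => (hu θ).continuousAt
  have h0b : (0 : ℝ) ∈ Icc 0 b := ⟨le_rfl, hb.le⟩
  have hbb : b ∈ Icc 0 b := ⟨hb.le, le_rfl⟩
  have hpos : ∀ θ ∈ Ioo 0 b, 0 < sin (Ψ θ) → 0 < u' θ := by
    intro θ hθ hs
    obtain ⟨C, hC, h⟩ := hsign θ hθ
    rw [h]; positivity
  have hneg : ∀ θ ∈ Ioo 0 b, sin (Ψ θ) < 0 → u' θ < 0 := by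
    intro θ hθ hs
    obtain ⟨C, hC, h⟩ := hsign θ hθ
    rw [h]; exact mul_neg_of_pos_of_neg hC hs
  have hex : ∀ x ∈ Ioo 0 (2 * k * π), ∃ θ ∈ Ioo 0 b, Ψ θ = x := by
    intro x hx
    have := intermediate_value_Ioo hb.le hΨc
    rw [hΨ0, hΨb] at this
    exact this hx
  have hΨlt : ∀ θ ∈ Ioo 0 b, 0 < Ψ θ ∧ Ψ θ < 2 * k * π := by
    intro θ hθ
    have hθ' := Ioo_subset_Icc_self hθ
    exact ⟨hΨ0 ▸ hΨm h0b hθ' hθ.1, hΨb ▸ hΨm hθ' hbb hθ.2⟩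
  have hiff : ∀ θ ∈ Ioo 0 b, (IsLocalMax u θ ↔ ∃ m : ℕ, m < k ∧ Ψ θ = (2 * m + 1) * π) := by
    intro θ hθ
    have hθ' := Ioo_subset_Icc_self hθ
    have hcat : ContinuousAt Ψ θ := hΨc.continuousAt (Icc_mem_nhds hθ.1 hθ.2)
    constructor
    · intro hmax
      obtain ⟨C, hC, h1⟩ := hsign θ hθ
      have h2 := hmax.hasDerivAt_eq_zero (hu θ)
      rw [h1] at h2
      obtain ⟨j, hj⟩ := sin_eq_zero_iff.1 ((mul_eq_zero.1 h2).resolve_left hC.ne')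
      obtain ⟨h3, h4⟩ := hΨlt θ hθ
      rw [← hj] at h3 h4
      have hj0 : (0 : ℝ) < j := pos_of_mul_pos_left h3 pi_pos.le
      have hj1 : (j : ℝ) < 2 * k := lt_of_mul_lt_mul_right h4 pi_pos.le
      have hj0' : 0 < j := by exact_mod_cast hj0
      have hj1' : j < 2 * k := by exact_mod_cast hj1
      obtain ⟨m, hm | hm⟩ : ∃ m : ℕ, j = 2 * m ∨ j = 2 * m + 1 :=
        ⟨(j / 2).toNat, by omega⟩
      · -- At an even multiple of `π` the function increases strictly to the right.
        exfalso
        have hΨθ : Ψ θ = 2 * m * π := by rw [← hj, hm]; push_cast; ring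
        have hright : ∀ᶠ x in nhdsWithin θ (Ioi θ), u x ≤ u θ :=
          nhdsWithin_le_nhds hmax
        have hnear : ∀ᶠ x in nhds θ, Ψ x < (2 * m + 1) * π :=
          hcat.eventually (gt_mem_nhds (by rw [hΨθ]; nlinarith [pi_pos]))
        obtain ⟨ε, hε, hball⟩ := Metric.eventually_nhds_iff.1 (hnear.and (Ioo_mem_nhds hθ.1 hθ.2))
        have hmono : StrictMonoOn u (Ico θ (θ + ε)) := by
          refine strictMonoOn_of_deriv_pos (convex_Ico _ _) huc.continuousOn fun x hx => ?_
          rw [interior_Ico] at hx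
          have hx' := hball (show dist x θ < ε by
            rw [Real.dist_eq, abs_lt]; constructor <;> linarith [hx.1, hx.2])
          rw [(hu x).deriv]
          refine hpos x hx'.2 (sin_pos_of_mem_phase (m := m) ?_ hx'.1)
          rw [← hΨθ]
          exact hΨm hθ' (Ioo_subset_Icc_self hx'.2) hx.1
        obtain ⟨x, hx1, hx2⟩ := (hright.and (Ioo_mem_nhdsGT (show θ < θ + ε by linarith))).exists
        exact absurd hx1 (not_le.2 (hmono ⟨le_rfl, by linarith⟩ ⟨hx2.1.le, hx2.2⟩ hx2.1))
      · exact ⟨m, by omega, by rw [← hj, hm]; push_cast; ring⟩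
    · rintro ⟨m, -, hΨθ⟩
      have hnear : ∀ᶠ x in nhds θ, 2 * m * π < Ψ x ∧ Ψ x < (2 * m + 2) * π :=
        (hcat.eventually (lt_mem_nhds (by rw [hΨθ]; nlinarith [pi_pos]))).and
          (hcat.eventually (gt_mem_nhds (by rw [hΨθ]; nlinarith [pi_pos])))
      obtain ⟨ε, hε, hball⟩ := Metric.eventually_nhds_iff.1 (hnear.and (Ioo_mem_nhds hθ.1 hθ.2))
      have hball' : ∀ x ∈ Ioo (θ - ε) (θ + ε), (2 * m * π < Ψ x ∧ Ψ x < (2 * m + 2) * π) ∧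
          x ∈ Ioo 0 b := fun x hx => hball (by
        rw [Real.dist_eq, abs_lt]; constructor <;> linarith [hx.1, hx.2])
      have hl : MonotoneOn u (Ioc (θ - ε) θ) := by
        refine monotoneOn_of_deriv_nonneg (convex_Ioc _ _) huc.continuousOn
          (fun x _ => (hu x).differentiableAt.differentiableWithinAt) fun x hx => ?_
        rw [interior_Ioc] at hx
        have hx' := hball' x ⟨hx.1, by linarith [hx.2]⟩
        rw [(hu x).deriv]
        exact (hpos x hx'.2 (sin_pos_of_mem_phase hx'.1.1
          (by rw [← hΨθ]; exact hΨm (Ioo_subset_Icc_self hx'.2) hθ' hx.2))).le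
      have hr : AntitoneOn u (Ico θ (θ + ε)) := by
        refine antitoneOn_of_deriv_nonpos (convex_Ico _ _) huc.continuousOn
          (fun x _ => (hu x).differentiableAt.differentiableWithinAt) fun x hx => ?_
        rw [interior_Ico] at hx
        have hx' := hball' x ⟨by linarith [hx.1], hx.2⟩
        rw [(hu x).deriv]
        exact (hneg x hx'.2 (sin_neg_of_mem_phase
          (by rw [← hΨθ]; exact hΨm hθ' (Ioo_subset_Icc_self hx'.2) hx.1) hx'.1.2)).le
      filter_upwards [Ioo_mem_nhds (show θ - ε < θ by linarith) (show θ < θ + ε by linarith)]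
        with x hx
      rcases le_total x θ with hxθ | hxθ
      · exact hl ⟨hx.1, hxθ⟩ ⟨by linarith, le_rfl⟩ hxθ
      · exact hr ⟨le_rfl, by linarith⟩ ⟨hxθ, hx.2⟩ hxθ
  have hmem : ∀ m : ℕ, m < k → (2 * m + 1) * π ∈ Ioo 0 (2 * k * π) := by
    intro m hm
    have : (m : ℝ) + 1 ≤ k := by exact_mod_cast hm
    exact ⟨by positivity, by nlinarith [pi_pos]⟩
  choose! t ht1 ht2 using hex
  have hset : {θ : ℝ | θ ∈ Ioo 0 b ∧ IsLocalMax u θ} =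
      (fun m : ℕ => t ((2 * m + 1) * π)) '' (Finset.range k : Set ℕ) := by
    ext θ
    simp only [mem_ofPred_eq, mem_image, Finset.coe_range, mem_Iio]
    constructor
    · rintro ⟨hθ, hmax⟩
      obtain ⟨m, hm, h⟩ := (hiff θ hθ).1 hmax
      refine ⟨m, hm, hΨm.injOn (Ioo_subset_Icc_self (ht1 _ (hmem m hm)))
        (Ioo_subset_Icc_self hθ) ?_⟩
      rw [ht2 _ (hmem m hm), h]
    · rintro ⟨m, hm, rfl⟩
      exact ⟨ht1 _ (hmem m hm), (hiff _ (ht1 _ (hmem m hm))).2 ⟨m, hm, ht2 _ (hmem m hm)⟩⟩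
  have hinj : InjOn (fun m : ℕ => t ((2 * m + 1) * π)) (Finset.range k : Set ℕ) := by
    intro m hm m' hm' h
    simp only [Finset.coe_range, mem_Iio] at hm hm'
    have h1 := congrArg Ψ h
    simp only [ht2 _ (hmem m hm), ht2 _ (hmem m' hm')] at h1
    have h2 := mul_right_cancel₀ pi_ne_zero h1
    have h3 : (m : ℝ) = m' := by linarith
    exact_mod_cast h3
  rw [hset, hinj.encard_image, Set.encard_coe_eq_coe_finsetCard, Finset.card_range]

/-! ### The Laplacian of functions of the latitude -/

/-- The quadratic form `x² + y² - z² - w²` on `ℝ⁴`. On `𝕊³` it takes the value `cos 2θ` at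
`torusPoint θ η₁ η₂`. -/
def latitude (x : R4) : ℝ := x 0 ^ 2 + x 1 ^ 2 - x 2 ^ 2 - x 3 ^ 2

theorem contDiff_latitude {m : WithTop ℕ∞} : ContDiff ℝ m latitude := by
  unfold latitude; fun_prop

theorem sum_sq_coords (p : S3) : p.1 0 ^ 2 + p.1 1 ^ 2 + p.1 2 ^ 2 + p.1 3 ^ 2 = 1 := by
  have h := p.2
  rw [mem_sphere_zero_iff_norm, EuclideanSpace.norm_eq, Real.sqrt_eq_one] at h
  simpa [Fin.sum_univ_four] using h

theorem latitude_torusPoint (θ η₁ η₂ : ℝ) : latitude (torusPoint θ η₁ η₂).1 = cos (2 * θ) := by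
  have h : latitude (torusPoint θ η₁ η₂).1 = (cos θ * cos η₁) ^ 2 + (cos θ * sin η₁) ^ 2 -
    (sin θ * cos η₂) ^ 2 - (sin θ * sin η₂) ^ 2 := rfl
  rw [h, cos_two_mul]
  linear_combination (cos θ) ^ 2 * sin_sq_add_cos_sq η₁ -
      (sin θ) ^ 2 * sin_sq_add_cos_sq η₂ - sin_sq_add_cos_sq θ

theorem latitude_torusAct (α β : Circle) (x : S3) :
    latitude (torusAct α β x).1 = latitude x.1 := by
  have h1 := Circle.normSq_coe α
  have h2 := Circle.normSq_coe β
  rw [Complex.normSq_apply] at h1 h2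
  have h : latitude (torusAct α β x).1 = (((α : ℂ) * ⟨x.1 0, x.1 1⟩).re) ^ 2 +
    (((α : ℂ) * ⟨x.1 0, x.1 1⟩).im) ^ 2 - (((β : ℂ) * ⟨x.1 2, x.1 3⟩).re) ^ 2 -
    (((β : ℂ) * ⟨x.1 2, x.1 3⟩).im) ^ 2 := rfl
  rw [h, latitude]
  simp only [Complex.mul_re, Complex.mul_im]
  linear_combination ((x.1 0) ^ 2 + (x.1 1) ^ 2) * h1 - ((x.1 2) ^ 2 + (x.1 3) ^ 2) * h2

theorem abs_latitude_le_one (p : S3) : |latitude p.1| ≤ 1 := by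
  have := sum_sq_coords p
  rw [latitude, abs_le]
  constructor <;> nlinarith [sq_nonneg (p.1 0), sq_nonneg (p.1 1), sq_nonneg (p.1 2),
    sq_nonneg (p.1 3)]

/-- The conformal factor of the inverse stereographic projection. -/
noncomputable def stereoFactor (y : EuclideanSpace ℝ (Fin 3)) : ℝ := 4 * (‖y‖ ^ 2 + 4)⁻¹

theorem stereoFactor_pos (y : EuclideanSpace ℝ (Fin 3)) : 0 < stereoFactor y := by
  unfold stereoFactor; positivity

theorem hasFDerivAt_stereoFactor (y : EuclideanSpace ℝ (Fin 3)) :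
    HasFDerivAt stereoFactor ((-(stereoFactor y ^ 2 / 2)) • innerSL ℝ y) y := by
  have h1 : HasFDerivAt (fun y : EuclideanSpace ℝ (Fin 3) => ‖y‖ ^ 2 + 4)
      (2 • innerSL ℝ y) y := (hasStrictFDerivAt_norm_sq y).hasFDerivAt.add_const 4
  have hn : ‖y‖ ^ 2 + 4 ≠ 0 := by positivity
  refine (((hasDerivAt_inv hn).comp_hasFDerivAt y h1).const_mul 4).congr_fderiv ?_
  ext v
  simp only [stereoFactor, smul_apply, innerSL_apply_apply, smul_eq_mul,
    nsmul_eq_mul]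
  field_simp
  ring

/-- The chart of `𝕊³` centred at `p` is inverse stereographic projection from `-p`, written in
an orthonormal frame `ι` of the tangent space at `p`. -/
theorem exists_chartInv_eq (p : S3) : ∃ ι : EuclideanSpace ℝ (Fin 3) →ₗᵢ[ℝ] R4,
    (∀ y, inner ℝ (p : R4) (ι y) = 0) ∧
      ∀ y, chartInv p y = stereoFactor y • ι y + (2 * stereoFactor y - 1) • (p : R4) := by
  have : Fact (Module.finrank ℝ R4 = 3 + 1) := ⟨finrank_euclideanSpace_fin⟩
  let U := (OrthonormalBasis.fromOrthogonalSpanSingleton (𝕜 := ℝ) 3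
    (ne_zero_of_mem_unit_sphere (-p))).repr
  refine ⟨(Submodule.subtypeₗᵢ _).comp U.symm.toLinearIsometry, fun y => ?_, fun y => ?_⟩
  · have := Submodule.mem_orthogonal_singleton_iff_inner_right.1 (U.symm y).2
    exact neg_eq_zero.1 ((inner_neg_left (p : R4) _).symm.trans this)
  · have h1 : chartInv p y = ((stereographic' 3 (-p)).symm y : S3) := rfl
    have hU : ‖((U.symm y : _) : R4)‖ = ‖y‖ := by
      rw [Submodule.norm_coe, LinearIsometryEquiv.norm_map]
    rw [h1, stereographic'_symm_apply]
    change (‖((U.symm y : _) : R4)‖ ^ 2 + 4)⁻¹ • (4 : ℝ) • ((U.symm y : _) : R4) +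
      (‖((U.symm y : _) : R4)‖ ^ 2 + 4)⁻¹ • (‖((U.symm y : _) : R4)‖ ^ 2 - 4) • (-(p : R4)) =
      stereoFactor y • ((U.symm y : _) : R4) + _
    rw [hU, smul_smul, smul_smul, smul_neg, ← neg_smul]
    unfold stereoFactor
    have hn : ‖y‖ ^ 2 + 4 ≠ 0 := by positivity
    congr 2
    · ring
    · field_simp; ring

theorem extChartAt_self_eq_zero (p : S3) : extChartAt (𝓡 3) p p = 0 := by
  have : Fact (Module.finrank ℝ R4 = 3 + 1) := ⟨finrank_euclideanSpace_fin⟩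
  have h1 : extChartAt (𝓡 3) p p = stereographic' 3 (-p) p := rfl
  have h2 : stereographic (norm_eq_of_mem_sphere (-p)) p = 0 := stereographic_neg_apply p
  rw [h1]
  change (OrthonormalBasis.fromOrthogonalSpanSingleton 3
    (ne_zero_of_mem_unit_sphere (-p))).repr
    (stereographic (norm_eq_of_mem_sphere (-p)) p) = 0
  rw [h2, map_zero]

section Chart

variable {p : S3} {ι : EuclideanSpace ℝ (Fin 3) →ₗᵢ[ℝ] R4}

/-- The frame together with the base point is an orthonormal basis of `ℝ⁴`; this is the
completeness relation in coordinates. -/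
theorem sum_frame_mul_frame (hp : ∀ y, inner ℝ (p : R4) (ι y) = 0) (k l : Fin 4) :
    (∑ i : Fin 3, ι (EuclideanSpace.single i 1) k * ι (EuclideanSpace.single i 1) l) +
      p.1 k * p.1 l = if k = l then 1 else 0 := by
  let v : Fin 4 → R4 := Fin.snoc (fun i : Fin 3 => ι (EuclideanSpace.single i 1)) (p : R4)
  have hv : ∀ i : Fin 3, v i.castSucc = ι (EuclideanSpace.single i 1) := fun i => by
    simp only [v, Fin.snoc_castSucc]
  have hvl : v (Fin.last 3) = p := by simp only [v, Fin.snoc_last]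
  have hpp : inner ℝ (p : R4) (p : R4) = 1 := by
    rw [real_inner_self_eq_norm_sq, norm_eq_of_mem_sphere]; norm_num
  have horth : ∀ i j, inner ℝ (v i) (v j) = if i = j then 1 else 0 := by
    intro i j
    refine Fin.lastCases ?_ (fun i => ?_) i <;> refine Fin.lastCases ?_ (fun j => ?_) j
    · rw [hvl, hpp, if_pos rfl]
    · rw [hvl, hv, hp, if_neg (Fin.castSucc_lt_last j).ne']
    · rw [hvl, hv, real_inner_comm, hp, if_neg (Fin.castSucc_lt_last i).ne]
    · rw [hv, hv, ι.inner_map_map]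
      simp [EuclideanSpace.inner_single_left]
  let M : Matrix (Fin 4) (Fin 4) ℝ := Matrix.of fun i k => v i k
  have hM : M * M.transpose = 1 := by
    ext i j
    have := horth i j
    rw [real_inner_comm, PiLp.inner_apply] at this
    rw [Matrix.mul_apply, Matrix.one_apply, ← this]
    simp [M]
  have hM' : (M.transpose * M) k l = (1 : Matrix (Fin 4) (Fin 4) ℝ) k l := by
    rw [mul_eq_one_comm.1 hM]
  rw [Matrix.mul_apply, Matrix.one_apply, Fin.sum_univ_castSucc] at hM'
  simpa only [M, Matrix.transpose_apply, Matrix.of_apply, hv, hvl] using hM'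

theorem partialDeriv_chartInv
    (hc : ∀ y, chartInv p y = stereoFactor y • ι y + (2 * stereoFactor y - 1) • (p : R4))
    (i : Fin 3) (y : EuclideanSpace ℝ (Fin 3)) :
    partialDeriv i (chartInv p) y = stereoFactor y • ι (EuclideanSpace.single i 1) -
      (stereoFactor y ^ 2 * y i / 2) • (ι y + (2 : ℝ) • (p : R4)) := by
  have h1 := hasFDerivAt_stereoFactor y
  have h2 : HasFDerivAt (chartInv p) _ y :=
    ((h1.smul (ι.toContinuousLinearMap.hasFDerivAt (x := y))).add
      (((h1.const_mul 2).sub_const 1).smul_const (p : R4))).congr_of_eventuallyEq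
      (Filter.Eventually.of_forall hc)
  rw [partialDeriv, h2.fderiv]
  simp only [add_apply, smul_apply,
    ContinuousLinearMap.smulRight_apply, innerSL_apply_apply, EuclideanSpace.inner_single_right,
    LinearIsometry.coe_toContinuousLinearMap, smul_eq_mul, conj_trivial, one_mul]
  module

theorem roundMetric_eq (hp : ∀ y, inner ℝ (p : R4) (ι y) = 0)
    (hc : ∀ y, chartInv p y = stereoFactor y • ι y + (2 * stereoFactor y - 1) • (p : R4))
    (y : EuclideanSpace ℝ (Fin 3)) :
    roundMetric p y = stereoFactor y ^ 2 • (1 : Matrix (Fin 3) (Fin 3) ℝ) := by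
  ext i j
  have hpp : inner ℝ (p : R4) (p : R4) = 1 := by
    rw [real_inner_self_eq_norm_sq, norm_eq_of_mem_sphere]; norm_num
  have hp' : ∀ y, inner ℝ (ι y) (p : R4) = 0 := fun y => by rw [real_inner_comm, hp]
  have hρ : stereoFactor y * (‖y‖ ^ 2 + 4) = 4 := by
    unfold stereoFactor
    have hn : ‖y‖ ^ 2 + 4 ≠ 0 := by positivity
    field_simp
  rw [roundMetric, Matrix.of_apply, partialDeriv_chartInv hc, partialDeriv_chartInv hc]
  simp only [inner_sub_left, inner_sub_right, inner_add_left, inner_add_right, inner_smul_left,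
    inner_smul_right, hp, hp', hpp, ι.inner_map_map, real_inner_self_eq_norm_sq,
    EuclideanSpace.inner_single_left, EuclideanSpace.inner_single_right, conj_trivial,
    Matrix.smul_apply, Matrix.one_apply, smul_eq_mul]
  have hs : (EuclideanSpace.single i (1 : ℝ) : EuclideanSpace ℝ (Fin 3)).ofLp j =
      if i = j then 1 else 0 := by simp [eq_comm]
  rw [hs]
  linear_combination (stereoFactor y ^ 3 * y i * y j / 4) * hρ

end Chart

/-- In the conformally flat chart centred at `p`, the Laplace–Beltrami operator at `p` is the
Euclidean Laplacian: the conformal factor is critical and equal to `1` at the centre. -/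
theorem laplaceBeltrami_eq_sum {U : S3 → ℝ} {p : S3} {φ : EuclideanSpace ℝ (Fin 3) → ℝ}
    (hφ : ∀ z, U ((extChartAt (𝓡 3) p).symm z) = φ z) (hφ2 : ContDiff ℝ 2 φ) :
    laplaceBeltrami U p = ∑ i, partialDeriv i (partialDeriv i φ) 0 := by
  obtain ⟨ι, hp, hc⟩ := exists_chartInv_eq p
  have hg := roundMetric_eq hp hc
  have hφ' : (fun z => U ((extChartAt (𝓡 3) p).symm z)) = φ := funext hφ
  have hsqrt : ∀ y, √(roundMetric p y).det = stereoFactor y ^ 3 := by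
    intro y
    have h0 := stereoFactor_pos y
    rw [hg, Matrix.det_smul, Matrix.det_one, Fintype.card_fin, mul_one, ← pow_mul,
      show 2 * 3 = 3 * 2 by norm_num, pow_mul, sqrt_sq (by positivity)]
  have hinv : ∀ y, (roundMetric p y)⁻¹ = (stereoFactor y ^ 2)⁻¹ • (1 : Matrix _ _ ℝ) := by
    intro y
    have h0 := (stereoFactor_pos y).ne'
    rw [hg]
    refine Matrix.inv_eq_right_inv ?_
    rw [Matrix.smul_mul, Matrix.mul_smul, mul_one, smul_smul, mul_inv_cancel₀ (pow_ne_zero 2 h0),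
      one_smul]
  have h00 : stereoFactor 0 = 1 := by simp [stereoFactor]
  rw [laplaceBeltrami, extChartAt_self_eq_zero, hφ', hsqrt, h00, one_pow, inv_one, one_mul]
  refine Finset.sum_congr rfl fun i _ => ?_
  have hin : (fun y => √(roundMetric p y).det * ∑ j, (roundMetric p y)⁻¹ i j *
      partialDeriv j φ y) = fun y => stereoFactor y * partialDeriv i φ y := by
    ext y
    have h0 := (stereoFactor_pos y).ne'
    rw [hsqrt, hinv, Finset.sum_eq_single i]
    · simp only [Matrix.smul_apply, Matrix.one_apply_eq, smul_eq_mul]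
      field_simp
    · intro j _ hj
      simp [Matrix.one_apply_ne hj.symm]
    · simp
  have hd : DifferentiableAt ℝ (partialDeriv i φ) 0 := by
    have h1 : ContDiff ℝ 1 (fderiv ℝ φ) := hφ2.fderiv_right (by norm_num)
    exact (h1.differentiable one_ne_zero 0).clm_apply (differentiableAt_const _)
  rw [hin, partialDeriv, ((hasFDerivAt_stereoFactor 0).fun_mul hd.hasFDerivAt).fderiv]
  simp [h00, partialDeriv]

/-- The Laplacian of `f (latitude)`: a singular Sturm–Liouville operator in the latitude. -/
theorem laplaceBeltrami_comp_latitude {f f' f'' : ℝ → ℝ} (hf : ContDiff ℝ 2 f)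
    (hf' : ∀ s, HasDerivAt f (f' s) s) (hf'' : ∀ s, HasDerivAt f' (f'' s) s) (p : S3) :
    laplaceBeltrami (fun x : S3 => f (latitude x.1)) p =
      4 * ((1 - latitude p.1 ^ 2) * f'' (latitude p.1) - 2 * latitude p.1 * f' (latitude p.1)) := by
  obtain ⟨ι, hp, hc⟩ := exists_chartInv_eq p
  set s := latitude p.1 with hs
  set F : EuclideanSpace ℝ (Fin 3) → R4 :=
    fun y => stereoFactor y • ι y + (2 * stereoFactor y - 1) • (p : R4) with hF
  have hρ : ContDiff ℝ 2 stereoFactor :=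
    contDiff_const.mul (((contDiff_norm_sq ℝ).add contDiff_const).inv fun y => by positivity)
  have hF2 : ContDiff ℝ 2 F :=
    (hρ.smul ι.contDiff).add (((contDiff_const.mul hρ).sub contDiff_const).smul contDiff_const)
  have hφ2 : ContDiff ℝ 2 fun y => f (latitude (F y)) := hf.comp (contDiff_latitude.comp hF2)
  have hU : ∀ z, f (latitude ((extChartAt (𝓡 3) p).symm z).1) = f (latitude (F z)) :=
    fun z => by rw [hF]; simp only; rw [← hc z]; rfl
  rw [laplaceBeltrami_eq_sum hU hφ2]
  -- Along the `i`-th axis the chart runs through the great circle `C ι(eᵢ) + E p`.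
  set A : Fin 3 → ℝ := fun i => latitude (ι (EuclideanSpace.single i 1)) with hA
  set B : Fin 3 → ℝ := fun i => ι (EuclideanSpace.single i 1) 0 * p.1 0 +
    ι (EuclideanSpace.single i 1) 1 * p.1 1 - ι (EuclideanSpace.single i 1) 2 * p.1 2 -
    ι (EuclideanSpace.single i 1) 3 * p.1 3 with hB
  set ρ : ℝ → ℝ := fun t => 4 * (t ^ 2 + 4)⁻¹ with hρdef
  have hρd : ∀ t, HasDerivAt ρ (-(t * ρ t ^ 2 / 2)) t := by
    intro t
    have hn : t ^ 2 + 4 ≠ 0 := by positivity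
    refine ((((hasDerivAt_pow 2 t).add_const 4).inv hn).const_mul 4).congr_deriv ?_
    simp only [hρdef]
    field_simp
    push_cast
    ring
  set C : ℝ → ℝ := fun t => t * ρ t with hC
  set E : ℝ → ℝ := fun t => 2 * ρ t - 1 with hE
  have hCd : ∀ t, HasDerivAt C (ρ t * E t) t := by
    intro t
    have hn : t ^ 2 + 4 ≠ 0 := by positivity
    refine ((hasDerivAt_id t).mul (hρd t)).congr_deriv ?_
    simp only [hρdef, hE, id]
    field_simp
    ring
  have hEd : ∀ t, HasDerivAt E (-(ρ t * C t)) t := by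
    intro t
    refine (((hρd t).const_mul 2).sub_const 1).congr_deriv ?_
    simp only [hC]
    ring
  set σ : Fin 3 → ℝ → ℝ := fun i t => C t ^ 2 * A i + 2 * (C t * E t) * B i + E t ^ 2 * s with hσ
  have hline : ∀ i t, latitude (F (t • EuclideanSpace.single i 1)) = σ i t := by
    intro i t
    have h1 : stereoFactor (t • EuclideanSpace.single i 1) = ρ t := by
      simp [stereoFactor, hρdef, norm_smul]
    have h2 : ∀ k, F (t • EuclideanSpace.single i 1) k =
        C t * ι (EuclideanSpace.single i 1) k + E t * p.1 k := by
      intro k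
      simp only [hF, h1, map_smul, PiLp.add_apply, PiLp.smul_apply, smul_eq_mul, hC, hE]
      ring
    simp only [latitude, h2, hσ, hA, hB, hs]
    ring
  set σ' : Fin 3 → ℝ → ℝ := fun i t =>
    ρ t * (2 * (C t * E t) * A i + 2 * (E t ^ 2 - C t ^ 2) * B i - 2 * (C t * E t) * s) with hσ'
  have hσd : ∀ i t, HasDerivAt (σ i) (σ' i t) t := by
    intro i t
    refine (((((hCd t).pow 2).mul_const (A i)).add
      ((((hCd t).mul (hEd t)).const_mul 2).mul_const (B i))).add
      (((hEd t).pow 2).mul_const s)).congr_deriv ?_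
    simp only [hσ']
    ring
  have hρ0 : ρ 0 = 1 := by simp [hρdef]
  have hC0 : C 0 = 0 := by simp [hC]
  have hE0 : E 0 = 1 := by simp [hE, hρ0]; norm_num
  have hσ0 : ∀ i, σ i 0 = s := fun i => by simp [hσ, hC0, hE0]
  have hσ'0 : ∀ i, σ' i 0 = 2 * B i := fun i => by simp [hσ', hC0, hE0, hρ0]
  have hσ'd : ∀ i, HasDerivAt (σ' i) (2 * A i - 2 * s) 0 := by
    intro i
    have hCE := (hCd 0).mul (hEd 0)
    refine ((hρd 0).mul ((((hCE.const_mul 2).mul_const (A i)).add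
      (((((hEd 0).pow 2).sub ((hCd 0).pow 2)).const_mul 2).mul_const (B i))).sub
      ((hCE.const_mul 2).mul_const s))).congr_deriv ?_
    simp [hC0, hE0, hρ0]
  have hterm : ∀ i, partialDeriv i (partialDeriv i fun y => f (latitude (F y))) 0 =
      f'' s * (2 * B i) ^ 2 + f' s * (2 * A i - 2 * s) := by
    intro i
    set e : EuclideanSpace ℝ (Fin 3) := EuclideanSpace.single i 1 with he
    have hlin : ∀ t : ℝ, HasDerivAt (fun t : ℝ => t • e) e t := fun t => by
      simpa using (hasDerivAt_id t).smul_const e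
    have h1 : ∀ t, partialDeriv i (fun y => f (latitude (F y))) (t • e) =
        f' (σ i t) * σ' i t := by
      intro t
      have h2 := ((hφ2.differentiable two_ne_zero (t • e)).hasFDerivAt).comp_hasDerivAt t (hlin t)
      have h3 : HasDerivAt (fun t => f (σ i t)) (f' (σ i t) * σ' i t) t :=
        (hf' _).comp t (hσd i t)
      have h4 : ((fun y => f (latitude (F y))) ∘ fun t : ℝ => t • e) = fun t => f (σ i t) := by
        ext t; simp [Function.comp, he, hline]
      rw [h4] at h2
      exact h2.unique h3
    have hd : DifferentiableAt ℝ (partialDeriv i fun y => f (latitude (F y))) ((0 : ℝ) • e) := by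
      have h1 : ContDiff ℝ 1 (fderiv ℝ fun y => f (latitude (F y))) :=
        hφ2.fderiv_right (by norm_num)
      exact (h1.differentiable one_ne_zero _).clm_apply (differentiableAt_const _)
    have h2 := hd.hasFDerivAt.comp_hasDerivAt (0 : ℝ) (hlin 0)
    have h3 : HasDerivAt (fun t => f' (σ i t) * σ' i t) _ 0 :=
      ((hf'' _).comp (0 : ℝ) (hσd i 0)).mul (hσ'd i)
    have h4 : (partialDeriv i (fun y => f (latitude (F y))) ∘ fun t : ℝ => t • e) =
        fun t => f' (σ i t) * σ' i t := by
      ext t; simp [Function.comp, h1]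
    rw [h4] at h2
    have h5 := h2.unique h3
    rw [zero_smul] at h5
    have h6 : partialDeriv i (partialDeriv i fun y => f (latitude (F y))) 0 =
      (fderiv ℝ (partialDeriv i fun y => f (latitude (F y))) 0) e := rfl
    rw [h6, h5, Function.comp_apply, hσ0, hσ'0]
    ring
  rw [Finset.sum_congr rfl fun i _ => hterm i]
  have hcomp := fun k l => sum_frame_mul_frame (ι := ι) hp k l
  simp only [Fin.sum_univ_three] at hcomp ⊢
  have hAsum : A 0 + A 1 + A 2 + s = 0 := by
    simp only [hA, hs, latitude]
    have h0 := hcomp 0 0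
    have h1 := hcomp 1 1
    have h2 := hcomp 2 2
    have h3 := hcomp 3 3
    simp only [if_true] at h0 h1 h2 h3
    linear_combination h0 + h1 - h2 - h3
  have hBsum : B 0 ^ 2 + B 1 ^ 2 + B 2 ^ 2 + s ^ 2 = 1 := by
    have hpn := sum_sq_coords p
    have h00 := hcomp 0 0
    have h11 := hcomp 1 1
    have h22 := hcomp 2 2
    have h33 := hcomp 3 3
    have h01 := hcomp 0 1
    have h02 := hcomp 0 2
    have h03 := hcomp 0 3
    have h12 := hcomp 1 2
    have h13 := hcomp 1 3
    have h23 := hcomp 2 3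
    simp only [if_true] at h00 h11 h22 h33
    simp only [Fin.reduceEq, if_false] at h01 h02 h03 h12 h13 h23
    simp only [hB, hs, latitude]
    linear_combination p.1 0 ^ 2 * h00 + p.1 1 ^ 2 * h11 + p.1 2 ^ 2 * h22 + p.1 3 ^ 2 * h33 +
      2 * p.1 0 * p.1 1 * h01 - 2 * p.1 0 * p.1 2 * h02 - 2 * p.1 0 * p.1 3 * h03 -
      2 * p.1 1 * p.1 2 * h12 - 2 * p.1 1 * p.1 3 * h13 + 2 * p.1 2 * p.1 3 * h23 + hpn
  linear_combination 4 * f'' s * hBsum + 2 * f' s * hAsum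

/-! ### Reflection across the equator -/

/-- The derivative of `s ↦ g (1 - |s|)` when `y` is the derivative of `g`. -/
noncomputable def reflectedDeriv (y : ℝ → ℝ) (s : ℝ) : ℝ :=
  if 0 ≤ s then -y (1 - s) else y (1 + s)

theorem continuous_reflectedDeriv {y : ℝ → ℝ} (hy : Continuous y) (hy1 : y 1 = 0) :
    Continuous (reflectedDeriv y) :=
  Continuous.if_le (by fun_prop) (by fun_prop) continuous_const continuous_id fun s hs => by
    simp [← hs, hy1]

theorem hasDerivAt_reflection {g y : ℝ → ℝ} (hg : ∀ r, HasDerivAt g (y r) r)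
    (hy : Continuous y) (hy1 : y 1 = 0) (s : ℝ) :
    HasDerivAt (fun s => g (1 - |s|)) (reflectedDeriv y s) s := by
  have hgc : Continuous g := continuous_iff_continuousAt.2 fun r => (hg r).continuousAt
  refine hasDerivAt_of_hasDerivAt_of_ne' (x := 0) (fun s hs => ?_)
    (by fun_prop : Continuous fun s => g (1 - |s|)).continuousAt
    (continuous_reflectedDeriv hy hy1).continuousAt s
  rcases lt_or_gt_of_ne hs with hs | hs
  · rw [reflectedDeriv, if_neg (not_le.2 hs)]
    have h1 : HasDerivAt (fun s => g (1 + s)) (y (1 + s) * 1) s :=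
      (hg _).comp s ((hasDerivAt_id s).const_add 1)
    rw [mul_one] at h1
    refine h1.congr_of_eventuallyEq ?_
    filter_upwards [Iio_mem_nhds hs] with x hx
    rw [abs_of_neg hx, sub_neg_eq_add]
  · rw [reflectedDeriv, if_pos hs.le]
    have h1 : HasDerivAt (fun s => g (1 - s)) (y (1 - s) * -1) s :=
      (hg _).comp s ((hasDerivAt_id s).const_sub 1)
    rw [mul_neg_one] at h1
    refine h1.congr_of_eventuallyEq ?_
    filter_upwards [Ioi_mem_nhds hs] with x hx
    rw [abs_of_pos hx]

theorem hasDerivAt_reflectedDeriv {y w : ℝ → ℝ} (hyc : Continuous y)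
    (hy : ∀ r < 1, HasDerivAt y (w r) r) (hw : Continuous w) (hy1 : y 1 = 0) (s : ℝ) :
    HasDerivAt (reflectedDeriv y) (w (1 - |s|)) s := by
  refine hasDerivAt_of_hasDerivAt_of_ne' (x := 0) (g := fun s => w (1 - |s|)) (fun s hs => ?_)
    (continuous_reflectedDeriv hyc hy1).continuousAt
    (by fun_prop : Continuous fun s => w (1 - |s|)).continuousAt s
  rcases lt_or_gt_of_ne hs with hs | hs
  · have h1 : HasDerivAt (fun s => y (1 + s)) (w (1 + s) * 1) s :=
      (hy _ (by linarith)).comp s ((hasDerivAt_id s).const_add 1)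
    rw [mul_one] at h1
    rw [abs_of_neg hs, sub_neg_eq_add]
    refine h1.congr_of_eventuallyEq ?_
    filter_upwards [Iio_mem_nhds hs] with x hx
    rw [reflectedDeriv, if_neg (not_le.2 hx)]
  · have h1 : HasDerivAt (fun s => -y (1 - s)) (-(w (1 - s) * -1)) s :=
      ((hy (1 - s) (by linarith)).comp s ((hasDerivAt_id s).const_sub 1)).neg
    rw [mul_neg_one, neg_neg] at h1
    rw [abs_of_pos hs]
    refine h1.congr_of_eventuallyEq ?_
    filter_upwards [Ioi_mem_nhds hs] with x hx
    rw [reflectedDeriv, if_pos (le_of_lt hx)]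

theorem contDiff_two_of_hasDerivAt {f f' f'' : ℝ → ℝ} (h1 : ∀ s, HasDerivAt f (f' s) s)
    (h2 : ∀ s, HasDerivAt f' (f'' s) s) (h3 : Continuous f'') : ContDiff ℝ 2 f := by
  have e1 : deriv f = f' := funext fun s => (h1 s).deriv
  have e2 : deriv f' = f'' := funext fun s => (h2 s).deriv
  rw [show (2 : WithTop ℕ∞) = 1 + 1 by norm_num, contDiff_succ_iff_deriv]
  refine ⟨fun s => (h1 s).differentiableAt, by simp, ?_⟩
  rw [e1, contDiff_one_iff_deriv, e2]
  exact ⟨fun s => (h2 s).differentiableAt, h3⟩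

/-- The phase of a profile as a function of the polar angle `θ ∈ [0, π / 2]`, continued past the
equator `θ = π / 4` by reflection. -/
noncomputable def reflectedPhase (k : ℕ) (ψ : ℝ → ℝ) (θ : ℝ) : ℝ :=
  if θ ≤ π / 4 then ψ (1 - cos (2 * θ)) else 2 * k * π - ψ (1 + cos (2 * θ))

theorem continuous_reflectedPhase {k : ℕ} {ψ : ℝ → ℝ} (hψ : Continuous ψ) (h1 : ψ 1 = k * π) :
    Continuous (reflectedPhase k ψ) :=
  Continuous.if_le (by fun_prop) (by fun_prop) continuous_id continuous_const fun θ hθ => by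
    have : cos (2 * θ) = 0 := by
      rw [hθ, show 2 * (π / 4) = π / 2 by ring, cos_pi_div_two]
    rw [this, sub_zero, add_zero, h1]
    ring

theorem cos_two_mul_mem_of_le {θ : ℝ} (h0 : 0 ≤ θ) (h : θ ≤ π / 4) :
    1 - cos (2 * θ) ∈ Icc (0 : ℝ) 1 :=
  ⟨by linarith [cos_le_one (2 * θ)], by
    linarith [cos_nonneg_of_mem_Icc (x := 2 * θ) ⟨by linarith [pi_pos], by linarith⟩]⟩

theorem cos_two_mul_mem_of_ge {θ : ℝ} (h : π / 4 ≤ θ) (h1 : θ ≤ π / 2) :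
    1 + cos (2 * θ) ∈ Icc (0 : ℝ) 1 :=
  ⟨by linarith [neg_one_le_cos (2 * θ)], by
    linarith [cos_nonpos_of_pi_div_two_le_of_le (x := 2 * θ) (by linarith) (by linarith [pi_pos])]⟩

theorem strictMonoOn_reflectedPhase {k : ℕ} {ψ : ℝ → ℝ} (hψ : StrictMonoOn ψ (Icc 0 1))
    (h1 : ψ 1 = k * π) : StrictMonoOn (reflectedPhase k ψ) (Icc 0 (π / 2)) := by
  have hπ := pi_pos
  have hcos : ∀ x y, 0 ≤ x → y ≤ π / 2 → x < y → cos (2 * y) < cos (2 * x) := fun x y h0 h2 hxy =>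
    cos_lt_cos_of_nonneg_of_le_pi (by linarith) (by linarith) (by linarith)
  have hl : StrictMonoOn (reflectedPhase k ψ) (Icc 0 (π / 4)) := by
    intro x hx y hy hxy
    rw [reflectedPhase, reflectedPhase, if_pos hx.2, if_pos hy.2]
    exact hψ (cos_two_mul_mem_of_le hx.1 hx.2) (cos_two_mul_mem_of_le hy.1 hy.2)
      (by linarith [hcos x y hx.1 (by linarith [hy.2]) hxy])
  have he : ∀ x ∈ Icc (π / 4) (π / 2), reflectedPhase k ψ x = 2 * k * π - ψ (1 + cos (2 * x)) := by
    intro x hx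
    rcases hx.1.eq_or_lt with h | h
    · have : cos (2 * x) = 0 := by
        rw [← h, show 2 * (π / 4) = π / 2 by ring, cos_pi_div_two]
      rw [reflectedPhase, if_pos h.ge, this, sub_zero, add_zero, h1]
      ring
    · rw [reflectedPhase, if_neg (not_le.2 h)]
  have hr : StrictMonoOn (reflectedPhase k ψ) (Icc (π / 4) (π / 2)) := by
    intro x hx y hy hxy
    rw [he x hx, he y hy]
    have := hψ (cos_two_mul_mem_of_ge hy.1 hy.2) (cos_two_mul_mem_of_ge hx.1 hx.2)
      (by linarith [hcos x y (by linarith [hx.1]) hy.2 hxy])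
    linarith
  have := hl.union hr (isGreatest_Icc (by positivity)) (isLeast_Icc (by linarith))
  rwa [Icc_union_Icc_eq_Icc (by positivity) (by linarith)] at this

theorem theorem1p1 (n : ℕ) (hn : 1 ≤ n) (lam : ℝ)
    (hlam : lam ∈ Set.Ico (-((2 * (n : ℝ) + 2) * (2 * (n : ℝ) + 3)))
      (-((2 * (n : ℝ)) * (2 * (n : ℝ) + 1))))
    (k : ℕ) (hk : 1 ≤ k) (hkn : k ≤ n) :
    ∃ (U : S3 → ℝ) (u : ℝ → ℝ),
      IsGroundState lam U ∧
      TorusInvariant U ∧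
      (∀ θ ∈ Set.Icc (0 : ℝ) (Real.pi / 2), ∀ η₁ η₂ : ℝ, U (torusPoint θ η₁ η₂) = u θ) ∧
      {θ : ℝ | θ ∈ Set.Ioo (0 : ℝ) (Real.pi / 2) ∧ IsLocalMax u θ}.encard = (k : ℕ∞) ∧
      (∀ θ ∈ Set.Icc (0 : ℝ) (Real.pi / 2), u (Real.pi / 2 - θ) = u θ) ∧
      u 0 < 1 := by
  have hπ := pi_pos
  have hc : 2 * (n : ℝ) * (2 * n + 1) < 4 * (-lam / 4) := by linarith [hlam.2]
  have hc0 : 0 < -lam / 4 := by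
    have : (0 : ℝ) ≤ 2 * n * (2 * n + 1) := by positivity
    linarith
  obtain ⟨d, hd, g, y, P, hprof, hphase⟩ := exists_profile_phase_eq hn hc hk hkn
  have hreg := hprof.regularSolution hc0 hd
  set ψ := phase (fun r => -lam / 4 * nonlinQuot (g r)) (fun r => g r - 1) y P with hψ
  obtain ⟨w, hw, hyw, hode⟩ := hprof.exists_deriv2
  have hy1 : y 1 = 0 := by
    obtain ⟨C, -, -, h2⟩ := hreg.exists_polar (show (1 : ℝ) ∈ Icc 0 1 by simp)
    rw [← hψ, hphase, sin_nat_mul_pi, mul_zero, hprof.flux_eq 1 le_rfl] at h2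
    linarith
  set f : ℝ → ℝ := fun s => g (1 - |s|) with hf
  have hf1 : ∀ s, HasDerivAt f (reflectedDeriv y s) s :=
    hasDerivAt_reflection hprof.hasDerivAt_g hprof.continuous_y hy1
  have hf2 : ∀ s, HasDerivAt (reflectedDeriv y) (w (1 - |s|)) s :=
    hasDerivAt_reflectedDeriv hprof.continuous_y hyw hw hy1
  have hfC : ContDiff ℝ 2 f := contDiff_two_of_hasDerivAt hf1 hf2 (by fun_prop)
  have hmem : ∀ x : S3, 1 - |latitude x.1| ∈ Icc (0 : ℝ) 1 := fun x =>
    ⟨by linarith [abs_latitude_le_one x], by linarith [abs_nonneg (latitude x.1)]⟩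
  refine ⟨fun x => f (latitude x.1), fun θ => f (cos (2 * θ)), ⟨?_, fun x => ?_, fun x => ?_⟩,
    fun α β x => ?_, fun θ _ η₁ η₂ => ?_, ?_, fun θ _ => ?_, ?_⟩
  · have : Fact (Module.finrank ℝ R4 = 3 + 1) := ⟨finrank_euclideanSpace_fin⟩
    exact hfC.contMDiff.comp (contDiff_latitude.contMDiff.comp contMDiff_coe_sphere)
  · rw [laplaceBeltrami_comp_latitude hfC hf1 hf2]
    set s := latitude x.1
    have h1 := hode (1 - |s|) (hmem x).2
    rw [nonlin_of_abs_le (hprof.abs_g_le hc0 hd (hmem x))] at h1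
    change _ = lam * (g (1 - |s|) ^ 5 - g (1 - |s|))
    rcases le_or_gt 0 s with hs | hs
    · rw [reflectedDeriv, if_pos hs]
      rw [abs_of_nonneg hs] at h1 ⊢
      linear_combination 4 * h1
    · rw [reflectedDeriv, if_neg (not_le.2 hs)]
      rw [abs_of_neg hs, sub_neg_eq_add] at h1 ⊢
      linear_combination 4 * h1
  · exact (hprof.mem_Ioo hc0 hd (hmem x)).1
  · simp only [latitude_torusAct]
  · simp only [latitude_torusPoint]
  · have hu : ∀ θ, HasDerivAt (fun θ => f (cos (2 * θ)))
        (reflectedDeriv y (cos (2 * θ)) * -(2 * sin (2 * θ))) θ := by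
      intro θ
      have h1 : HasDerivAt (fun θ : ℝ => cos (2 * θ)) (-(2 * sin (2 * θ))) θ :=
        (((hasDerivAt_id θ).const_mul 2).cos).congr_deriv (by simp; ring)
      exact (hf1 _).comp θ h1
    refine encard_isLocalMax_eq (by positivity) hu
      (continuous_reflectedPhase hreg.continuous_phase hphase).continuousOn
      (strictMonoOn_reflectedPhase hreg.strictMonoOn_phase hphase) ?_ ?_ fun θ hθ => ?_
    · rw [reflectedPhase, if_pos (by positivity)]
      simp
    · rw [reflectedPhase, if_neg (by linarith), show 2 * (π / 2) = π by ring, cos_pi]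
      simp
    · have hsin : 0 < sin (2 * θ) := sin_pos_of_pos_of_lt_pi (by linarith [hθ.1]) (by linarith [hθ.2])
      have hsq := sin_sq_add_cos_sq (2 * θ)
      rcases le_or_gt θ (π / 4) with hle | hgt
      · have hr := cos_two_mul_mem_of_le hθ.1.le hle
        obtain ⟨C, hC, -, h2⟩ := hreg.exists_polar hr
        rw [hprof.flux_eq _ hr.2] at h2
        refine ⟨2 * C / sin (2 * θ), by positivity, ?_⟩
        rw [reflectedPhase, if_pos hle, reflectedDeriv, if_pos (by linarith [hr.2]), div_mul_eq_mul_div,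
          mul_assoc, ← h2]
        field_simp
        linear_combination y (1 - cos (2 * θ)) * hsq
      · have hr := cos_two_mul_mem_of_ge hgt.le hθ.2.le
        obtain ⟨C, hC, -, h2⟩ := hreg.exists_polar hr
        rw [hprof.flux_eq _ hr.2] at h2
        refine ⟨2 * C / sin (2 * θ), by positivity, ?_⟩
        have hneg : cos (2 * θ) < 0 :=
          cos_neg_of_pi_div_two_lt_of_lt (by linarith) (by linarith [hθ.2])
        have hs : sin (2 * k * π - ψ (1 + cos (2 * θ))) = -sin (ψ (1 + cos (2 * θ))) := by
          rw [show 2 * k * π - ψ (1 + cos (2 * θ)) = k * (2 * π) - ψ (1 + cos (2 * θ)) by ring,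
            sin_nat_mul_two_pi_sub]
        rw [reflectedPhase, if_neg (not_le.2 hgt), reflectedDeriv, if_neg (not_le.2 hneg), hs,
          div_mul_eq_mul_div, mul_neg, mul_neg, mul_assoc, ← h2]
        field_simp
        linear_combination -y (1 + cos (2 * θ)) * hsq
  · have h1 : cos (2 * (π / 2 - θ)) = -cos (2 * θ) := by
      rw [show 2 * (π / 2 - θ) = π - 2 * θ by ring, cos_pi_sub]
    simp only [hf, h1, abs_neg]
  · simp only [hf, mul_zero, cos_zero, abs_one, sub_self, hprof.g_zero]
    exact hd.2
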